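/- **Theorem 2.** Let $H_1,H_2$ be separable real Hilbert spaces, $\Psi:H_1\to H_2$ a bounded linear operator, and $$Y_k=\Psi(X_k)+\varepsilon_k,\qquad k\ge 1,$$ where all random variables are defined on one probability space. For $x\in H_i$, $y\in H_j$ write $x\otimes y$ for the operator $v\mapsto\langle x,v\rangle y$. Assume the following. (i) There are i.i.d. random elements $(\delta_i)_{i\in\mathbb Z}$ of a measurable space $S$ and measurable $f:S^{\mathbb N}\to H_1$, $g:S^{\mathbb N}\to H_2$ such that, for all $k\ge1$, almost surely $X_k=f(\delta_k,\delta_{k-1},\dots)$ and $\varepsilon_k=g(\delta_k,\delta_{k-1},\dots)$. Moreover $E\|X_k\|^4<\infty$, $E\|\varepsilon_k\|^4<\infty$, and $$\sum_{m\ge1}\big(E\|X_m-X_m^{(m)}\|^4\big)^{1/4}<\infty,\qquad \sum_{m\ge1}\big(E\|\varepsilon_m-\varepsilon_m^{(m)}\|^4\big)^{1/4}<\infty,$$ where $X_m^{(m)}=f(\delta_m,\dots,\delta_1,\delta_0',\delta_{-1}',\dots)$, $\varepsilon_m^{(m)}=g(\delta_m,\dots,\delta_1,\delta_0',\delta_{-1}',\dots)$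 and $(\delta_i')$ is an independent copy of $(\delta_i)$ (on an enlarged probability space if necessary). That is, $(X_k)$ and $(\varepsilon_k)$ are $L^4$-$m$-approximable with common innovations. (ii) $EX_k=0$ and $E\varepsilon_k=0$ for all $k\geq 1$; $(\varepsilon_k)$ is $H_2$-white noise, i.e. $E[\varepsilon_k\otimes\varepsilon_l]=0$ for $k\ne l$ and the covariance operator of $\varepsilon_k$ does not depend on $k$; and $E[X_k\otimes\varepsilon_k]=0$ for all $k\ge1$. Let $\hat C_n=\frac1n\sum_{k=1}^nX_k\otimes X_k$ and $\hat\Delta_n=\frac1n\sum_{k=1}^nX_k\otimes Y_k$. Let $\hat\lambda_1\ge\hat\lambda_2\ge\dots\ge0$ be the eigenvalues of $\hat C_n$, listed with multiplicity and continued by zeros, and let $\hat v_1,\hat v_2,\dots$ be any choice of corresponding eigenvectors such that those belonging to nonzero eigenvalues form an orthonormal basis of the image of $\hat C_n$. Let $(m_n)$ be real numbers with $m_n\to\infty$ and $m_n=o(\sqrt n)$, and put $$K_n=\arg\max\{j\ge1:\hat\lambda_1/\hat\lambda_j\le m_n\},\qquad \hat\Psi_{K_n}(x)=\sum_{j=1}^{K_n}\frac{\hat\Delta_n(\hat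 v_j)}{\hat\lambda_j}\langle\hat v_j,x\rangle ,$$ where only $j$ with $\hat\lambda_j>0$ are admitted, and $K_n=0$, $\hat\Psi_{K_n}=0$ if there is no such $j$. Then $$\|\Psi(X_n)-\hat\Psi_{K_n}(X_n)\|_{H_2}\to0\quad\text{in probability as } n\to\infty .$$ -/

import Mathlib

open MeasureTheory ProbabilityTheory Filter Topology
open scoped ENNReal RealInnerProductSpace

noncomputable section

namespace FunctionalRegression

variable {Ω S H H₁ H₂ : Type*}

section Operators

variable [NormedAddCommGroup H] [InnerProductSpace ℝ H]
  [NormedAddCommGroup H₁] [InnerProductSpace ℝ H₁]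
  [NormedAddCommGroup H₂] [InnerProductSpace ℝ H₂]

/-- The operator `x ⊗ y : H₁ → H₂`, `v ↦ ⟪x, v⟫ y`. -/
def tens (x : H₁) (y : H₂) : H₁ →L[ℝ] H₂ := (innerSL ℝ x).smulRight y

/-- `n⁻¹ ∑_{k=1}^n X_k ⊗ Y_k`. -/
def crossCovHat (X : ℕ → Ω → H₁) (Y : ℕ → Ω → H₂) (n : ℕ) (ω : Ω) : H₁ →L[ℝ] H₂ :=
  (n : ℝ)⁻¹ • ∑ k ∈ Finset.Icc 1 n, tens (X k ω) (Y k ω)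

/-- The empirical covariance operator `n⁻¹ ∑_{k=1}^n X_k ⊗ X_k`. -/
def covHat (X : ℕ → Ω → H) (n : ℕ) (ω : Ω) : H →L[ℝ] H := crossCovHat X X n ω

/-- `(lam j, v j)`, `j ≥ 1`, lists the eigenvalues of the nonnegative compact operator `T` in
decreasing order, with multiplicity, and corresponding eigenvectors: the eigenvectors that belong
to the nonzero eigenvalues form an orthonormal basis of the closure of the image of `T`.
If `T` has finite rank the list of eigenvalues is continued by zeros; nothing but `T (v j) = 0`
is required of the corresponding `v j`. The entry with index `0` plays no role. -/
structure IsEigenSystem (T : H →L[ℝ] H) (lam : ℕ → ℝ) (v : ℕ → H) : Prop where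
  antitone : AntitoneOn lam (Set.Ici 1)
  nonneg : ∀ j, 1 ≤ j → 0 ≤ lam j
  eigen : ∀ j, 1 ≤ j → T (v j) = lam j • v j
  orthonormal : Orthonormal ℝ (fun j : {j : ℕ // 1 ≤ j ∧ lam j ≠ 0} => v j)
  complete : closure (Submodule.span ℝ (v '' {j | 1 ≤ j ∧ lam j ≠ 0}) : Set H)
    = closure (Set.range T)

/-- `K = argmax {j ≥ 1 | lam 1 / lam j ≤ m}`, where the ratio counts as infinite if `lam j = 0`;
`K = 0` if there is no such `j`. -/
def truncLevel (lam : ℕ → ℝ) (m : ℝ) : ℕ :=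
  sSup {j : ℕ | 1 ≤ j ∧ 0 < lam j ∧ lam 1 / lam j ≤ m}

/-- The principal components estimator `x ↦ ∑_{j=1}^K ⟪v j, x⟫ / lam j • D (v j)`. -/
def pcEstimator (D : H₁ →L[ℝ] H₂) (lam : ℕ → ℝ) (v : ℕ → H₁) (K : ℕ) (x : H₁) : H₂ :=
  ∑ j ∈ Finset.Icc 1 K, (⟪v j, x⟫ / lam j) • D (v j)

end Operators

section Processes

variable [MeasurableSpace Ω] [MeasurableSpace S]

/-- `(δ i)`, `i ∈ ℤ`, are i.i.d. random elements of `S`. -/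
structure IsIID (P : Measure Ω) (δ : ℤ → Ω → S) : Prop where
  measurable : ∀ i, Measurable (δ i)
  indep : iIndepFun δ P
  ident : ∀ i, IdentDistrib (δ i) (δ 0) P P

/-- The sequence `(δ_n, δ_{n-1}, δ_{n-2}, …)`. -/
def past (δ : ℤ → Ω → S) (n : ℤ) (ω : Ω) : ℕ → S := fun i => δ (n - i) ω

/-- The sequence `(δ_n, …, δ_{n-m+1}, δ'_{n-m}, δ'_{n-m-1}, …)`, where `δ'` is the independent
copy of `δ` that lives on the second factor of the product space `Ω × Ω`. -/
def coupledPast (δ : ℤ → Ω → S) (n : ℤ) (m : ℕ) (z : Ω × Ω) : ℕ → S :=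
  fun i => if i < m then δ (n - i) z.1 else δ (n - i) z.2

/-- `(X n)`, `n ≥ 1`, is an `L^p`-`m`-approximable sequence driven by the i.i.d. sequence `δ`:
it has `p` moments, `X_n = f (δ_n, δ_{n-1}, …)` with `f` measurable, and
`∑_{m ≥ 1} (E ‖X_m - X_m^{(m)}‖^p)^{1/p} < ∞` for
`X_m^{(m)} = f (δ_m, …, δ_1, δ'_0, δ'_{-1}, …)`. -/
structure IsLpMApproximable [NormedAddCommGroup H] [MeasurableSpace H]
    (p : ℝ≥0∞) (P : Measure Ω) (δ : ℤ → Ω → S) (X : ℕ → Ω → H) : Prop where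
  iid : IsIID P δ
  memLp : ∀ n, 1 ≤ n → MemLp (X n) p P
  approx : ∃ f : (ℕ → S) → H, Measurable f ∧
    (∀ n, 1 ≤ n → X n =ᵐ[P] fun ω => f (past δ n ω)) ∧
    ∑' m : ℕ, eLpNorm (fun z : Ω × Ω => X (m + 1) z.1 - f (coupledPast δ (m + 1 : ℕ) (m + 1) z))
      p (P.prod P) < ∞

/-- `X ⊥ Y`: `E[X ⊗ Y] = 0`. -/
def IsOrthogonal [NormedAddCommGroup H₁] [InnerProductSpace ℝ H₁]
    [NormedAddCommGroup H₂] [InnerProductSpace ℝ H₂]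
    (P : Measure Ω) (X : Ω → H₁) (Y : Ω → H₂) : Prop :=
  ∫ ω, tens (X ω) (Y ω) ∂P = 0

/-- The covariance operator `E[(X - EX) ⊗ (X - EX)]`. -/
def covOp [NormedAddCommGroup H] [InnerProductSpace ℝ H]
    (P : Measure Ω) (X : Ω → H) : H →L[ℝ] H :=
  ∫ ω, tens (X ω - ∫ ω', X ω' ∂P) (X ω - ∫ ω', X ω' ∂P) ∂P

/-- `(ε k)`, `k ≥ 1`, is `H`-white noise: square integrable, pairwise orthogonal, with constant
mean and constant covariance operator. -/
structure IsWhiteNoise [NormedAddCommGroup H] [InnerProductSpace ℝ H]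
    (P : Measure Ω) (ε : ℕ → Ω → H) : Prop where
  memLp : ∀ k, 1 ≤ k → MemLp (ε k) 2 P
  orthogonal : ∀ k l, 1 ≤ k → 1 ≤ l → k ≠ l → IsOrthogonal P (ε k) (ε l)
  mean : ∀ k, 1 ≤ k → ∫ ω, ε k ω ∂P = ∫ ω, ε 1 ω ∂P
  cov : ∀ k, 1 ≤ k → covOp P (ε k) = covOp P (ε 1)

/-- The assumptions on regressors `(X k)` and noise `(ε k)`, `k ≥ 1`: both are centred and
`L⁴`-`m`-approximable, driven by the same i.i.d. sequence `δ`; `(ε k)` is white noise; and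
`X k ⊥ ε k`. -/
structure AssumptionA [NormedAddCommGroup H₁] [InnerProductSpace ℝ H₁] [MeasurableSpace H₁]
    [NormedAddCommGroup H₂] [InnerProductSpace ℝ H₂] [MeasurableSpace H₂]
    (P : Measure Ω) (δ : ℤ → Ω → S) (X : ℕ → Ω → H₁) (ε : ℕ → Ω → H₂) : Prop where
  approx_X : IsLpMApproximable 4 P δ X
  approx_ε : IsLpMApproximable 4 P δ ε
  mean_X : ∀ k, 1 ≤ k → ∫ ω, X k ω ∂P = 0
  mean_ε : ∀ k, 1 ≤ k → ∫ ω, ε k ω ∂P = 0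
  whiteNoise : IsWhiteNoise P ε
  orthogonal : ∀ k, 1 ≤ k → IsOrthogonal P (X k) (ε k)

end Processes

end FunctionalRegression

end

/-
Let `C = E[X₁ ⊗ X₁]` and let `π` be the projection onto the first `K_n` sample eigenvectors. Since
`Δ̂_n = Ψ Ĉ_n + L_n` with the noise operator `L_n = n⁻¹ ∑ X_k ⊗ ε_k`, the error at `X_n` is
`Ψ (X_n - π X_n) - L_n (Ĉ_n⁻¹ π X_n)`, and the two terms tend to zero without any assumption on the
gaps between the eigenvalues of `C`.

* `X_n` lies a.s. in the closure of the range of `C`, so it is close to some `C u`. The cutoff gives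
  `‖Ĉ_n - π Ĉ_n‖ ≤ λ̂₁ / m_n`, hence `‖X_n - π X_n‖ ≤ ‖X_n - C u‖ + (‖Ĉ_n - C‖ + λ̂₁ / m_n) ‖u‖`.
* On the first `K_n` components the inverse of `Ĉ_n` has norm at most `m_n / λ̂₁`, so the second
  term is at most `m_n ‖L_n‖ / ‖Ĉ_n‖ * ‖X_n‖`, where `m_n ‖L_n‖ → 0` because `‖L_n‖` is of
  order `n ^ (-1 / 2)`.

The rates of `Ĉ_n` and `L_n` come from a second moment bound in the Hilbert space tensor product.
There `X_k ⊗ ε_k` is again a functional of `δ_k, δ_{k-1}, …`, and replacing the innovations up to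
time `k` in the `(k + m)`-th term by an independent copy makes it independent of the `k`-th one;
the covariance at lag `m` is therefore bounded by the `L²` size of this replacement, which is
summable in `m`.
-/

noncomputable section

namespace FunctionalRegression

section ConvergenceInMeasure

variable {α ι E : Type*} [MeasurableSpace α] {μ : Measure α} {l : Filter ι}

lemma tendsto_measure_zero_of_subset {A B : ι → Set α}
    (hB : Tendsto (fun i => μ (B i)) l (𝓝 0)) (h : ∀ᶠ i in l, A i ⊆ B i) :
    Tendsto (fun i => μ (A i)) l (𝓝 0) :=
  tendsto_of_tendsto_of_tendsto_of_le_of_le' tendsto_const_nhds hB (.of_forall fun _ => zero_le)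
    (h.mono fun _ hi => measure_mono hi)

lemma tendsto_measure_zero_of_ae_mem_or_mem {A B C : ι → Set α}
    (hB : Tendsto (fun i => μ (B i)) l (𝓝 0)) (hC : Tendsto (fun i => μ (C i)) l (𝓝 0))
    (h : ∀ᶠ i in l, ∀ᵐ x ∂μ, x ∈ A i → x ∈ B i ∨ x ∈ C i) : Tendsto (fun i => μ (A i)) l (𝓝 0) := by
  have hBC : Tendsto (fun i => μ (B i) + μ (C i)) l (𝓝 0) := by simpa using hB.add hC
  refine tendsto_of_tendsto_of_tendsto_of_le_of_le' tendsto_const_nhds hBC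
    (.of_forall fun _ => zero_le) ?_
  filter_upwards [h] with i hi using (measure_mono_ae hi).trans (measure_union_le _ _)

lemma tendstoInMeasure_zero_iff [SeminormedAddCommGroup E] {f : ι → α → E} :
    TendstoInMeasure μ f l (fun _ => 0) ↔
      ∀ e : ℝ, 0 < e → Tendsto (fun i => μ {x | e ≤ ‖f i x‖}) l (𝓝 0) := by
  simp_rw [tendstoInMeasure_iff_norm, sub_zero]

lemma tendstoInMeasure_zero_of_norm_le_add [SeminormedAddCommGroup E] {f : ι → α → E}
    {g h : ι → α → ℝ} (hg : TendstoInMeasure μ g l (fun _ => 0))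
    (hh : TendstoInMeasure μ h l (fun _ => 0))
    (hle : ∀ᶠ i in l, ∀ᵐ x ∂μ, ‖f i x‖ ≤ g i x + h i x) :
    TendstoInMeasure μ f l (fun _ => 0) := by
  rw [tendstoInMeasure_zero_iff] at *
  intro e he
  refine tendsto_measure_zero_of_ae_mem_or_mem (hg (e / 2) (half_pos he)) (hh (e / 2) (half_pos he))
    (hle.mono fun i hi => ?_)
  filter_upwards [hi] with x hx (hex : e ≤ ‖f i x‖)
  refine (le_or_gt (e / 2) ‖g i x‖).imp id fun hgx => ?_
  change e / 2 ≤ ‖h i x‖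
  linarith [Real.le_norm_self (g i x), Real.le_norm_self (h i x)]

lemma tendstoInMeasure_const_mul {f : ι → α → ℝ} (hf : TendstoInMeasure μ f l (fun _ => 0))
    (c : ℝ) : TendstoInMeasure μ (fun i x => c * f i x) l (fun _ => 0) := by
  rw [tendstoInMeasure_zero_iff] at *
  intro e he
  refine tendsto_measure_zero_of_subset (hf (e / (|c| + 1)) (by positivity))
    (.of_forall fun i x (hx : e ≤ ‖c * f i x‖) => ?_)
  rw [norm_mul, Real.norm_eq_abs c] at hx
  change e / (|c| + 1) ≤ ‖f i x‖
  rw [div_le_iff₀ (by positivity)]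
  linarith [norm_nonneg (f i x)]

lemma tendstoInMeasure_of_tendsto_const [PseudoEMetricSpace E] {a : ι → E} {b : E}
    (h : Tendsto a l (𝓝 b)) : TendstoInMeasure μ (fun i _ => a i) l (fun _ => b) := by
  intro e he
  refine tendsto_const_nhds.congr' ?_
  filter_upwards [(tendsto_iff_edist_tendsto_0.1 h).eventually_lt_const he] with i hi
  simp [hi.not_ge]

lemma tendstoInMeasure_zero_of_norm_le [SeminormedAddCommGroup E] {f : ι → α → E}
    {g : ι → α → ℝ} (hg : TendstoInMeasure μ g l (fun _ => 0))
    (hle : ∀ᶠ i in l, ∀ᵐ x ∂μ, ‖f i x‖ ≤ g i x) : TendstoInMeasure μ f l (fun _ => 0) :=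
  tendstoInMeasure_zero_of_norm_le_add hg (tendstoInMeasure_of_tendsto_const tendsto_const_nhds)
    (by simpa only [add_zero] using hle)

lemma tendstoInMeasure_div {f g : ι → α → ℝ} {c : ℝ}
    (hf : TendstoInMeasure μ f l (fun _ => 0)) (hg : TendstoInMeasure μ g l (fun _ => c))
    (hc : c ≠ 0) : TendstoInMeasure μ (fun i x => f i x / g i x) l (fun _ => 0) := by
  rw [tendstoInMeasure_zero_iff] at *
  rw [tendstoInMeasure_iff_norm] at hg
  have hc' : 0 < |c| := abs_pos.2 hc
  intro e he
  refine tendsto_measure_zero_of_ae_mem_or_mem (hg (|c| / 2) (by positivity))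
    (hf (e * (|c| / 2)) (by positivity))
    (.of_forall fun i => .of_forall fun x (hx : e ≤ ‖f i x / g i x‖) => ?_)
  refine (le_or_gt (|c| / 2) ‖g i x - c‖).imp id fun hgx => ?_
  have hlow : |c| / 2 < ‖g i x‖ := by
    have := norm_sub_norm_le c (g i x)
    rw [norm_sub_rev, Real.norm_eq_abs c] at this
    linarith
  rw [norm_div, le_div_iff₀ (by linarith)] at hx
  exact (mul_le_mul_of_nonneg_left hlow.le he.le).trans hx

lemma tendstoInMeasure_zero_of_tendsto_integral_norm_sq [NormedAddCommGroup E] {f : ι → α → E}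
    (hf : ∀ i, MemLp (f i) 2 μ) (h : Tendsto (fun i => ∫ x, ‖f i x‖ ^ 2 ∂μ) l (𝓝 0)) :
    TendstoInMeasure μ f l (fun _ => 0) := by
  have hnorm : ∀ i, eLpNorm (f i - 0) 2 μ = ENNReal.ofReal √(∫ x, ‖f i x‖ ^ 2 ∂μ) := fun i => by
    simp [(hf i).eLpNorm_eq_integral_rpow_norm two_ne_zero ENNReal.ofNat_ne_top, Real.sqrt_eq_rpow]
  refine tendstoInMeasure_of_tendsto_eLpNorm (g := 0) two_ne_zero (fun i => (hf i).1)
    aestronglyMeasurable_zero ?_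
  simp_rw [hnorm]
  simpa using ENNReal.tendsto_ofReal h.sqrt

end ConvergenceInMeasure

section IdenticallyDistributed

variable {Ω ι E : Type*} [MeasurableSpace Ω] {P : Measure Ω} [IsFiniteMeasure P] {l : Filter ι}
  [MeasurableSpace E] {X : ι → Ω → E} {X₀ : Ω → E}

lemma tendsto_measure_zero_of_forall_inter_preimage
    (hX : ∀ᶠ i in l, IdentDistrib (X i) X₀ P P) {G : ℕ → Set E} (hGm : ∀ k, MeasurableSet (G k))
    (hGmono : Monotone G) (hG : ∀ᵐ ω ∂P, X₀ ω ∈ ⋃ k, G k) {A : ι → Set Ω}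
    (hA : ∀ k, Tendsto (fun i => P (A i ∩ X i ⁻¹' G k)) l (𝓝 0)) :
    Tendsto (fun i => P (A i)) l (𝓝 0) := by
  by_cases hl : l = ⊥
  · simp [hl]
  have hX₀ : AEMeasurable X₀ P := by
    have := neBot_iff.2 hl
    obtain ⟨i, hi⟩ := hX.exists
    exact hi.aemeasurable_snd
  have htail : Tendsto (fun k => P (X₀ ⁻¹' (G k)ᶜ)) atTop (𝓝 0) := by
    have hnull : P (⋂ k, X₀ ⁻¹' (G k)ᶜ) = 0 := by
      rw [ae_iff] at hG
      simpa only [← Set.preimage_iInter, ← Set.compl_iUnion] using! hG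
    rw [← hnull]
    exact tendsto_measure_iInter_atTop (fun k => hX₀.nullMeasurable (hGm k).compl)
      (fun i j hij => Set.preimage_mono (Set.compl_subset_compl.2 (hGmono hij)))
      ⟨0, measure_ne_top P _⟩
  rw [ENNReal.tendsto_nhds_zero]
  intro τ hτ
  obtain ⟨k, hk⟩ := (htail.eventually_le_const (ENNReal.half_pos hτ.ne')).exists
  filter_upwards [hX, (hA k).eventually_le_const (ENNReal.half_pos hτ.ne')] with i hXi hAi
  calc P (A i) ≤ P (A i ∩ X i ⁻¹' G k) + P (X i ⁻¹' (G k)ᶜ) :=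
        (measure_le_inter_add_sdiff P _ _).trans (add_le_add le_rfl (measure_mono fun ω hω => hω.2))
    _ ≤ τ / 2 + τ / 2 := add_le_add hAi ((hXi.measure_mem_eq (hGm k).compl).trans_le hk)
    _ = τ := ENNReal.add_halves τ

lemma tendstoInMeasure_mul_norm [SeminormedAddCommGroup E] [OpensMeasurableSpace E]
    (hX : ∀ᶠ i in l, IdentDistrib (X i) X₀ P P) {Z : ι → Ω → ℝ}
    (hZ : TendstoInMeasure P Z l (fun _ => 0)) :
    TendstoInMeasure P (fun i ω => Z i ω * ‖X i ω‖) l (fun _ => 0) := by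
  rw [tendstoInMeasure_zero_iff] at *
  intro e he
  refine tendsto_measure_zero_of_forall_inter_preimage hX
    (G := fun k : ℕ => Metric.ball 0 (k + 1)) (fun k => Metric.isOpen_ball.measurableSet)
    (fun i j hij => Metric.ball_subset_ball (by gcongr)) (.of_forall fun ω => ?_) fun k => ?_
  · obtain ⟨k, hk⟩ := exists_nat_gt ‖X₀ ω‖
    exact Set.mem_iUnion.2 ⟨k, by rw [mem_ball_zero_iff]; linarith⟩
  refine tendsto_measure_zero_of_subset (hZ (e / (k + 1)) (by positivity)) (.of_forall fun i => ?_)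
  rintro ω ⟨hZX, hXk⟩
  replace hZX : e ≤ ‖Z i ω * ‖X i ω‖‖ := hZX
  have hXk' : ‖X i ω‖ < k + 1 := mem_ball_zero_iff.1 hXk
  rw [norm_mul, norm_norm] at hZX
  change e / (k + 1) ≤ ‖Z i ω‖
  rw [div_le_iff₀ (by positivity)]
  exact hZX.trans (by gcongr)

lemma tendstoInMeasure_zero_of_le_dist_add {F : Type*} [SeminormedAddCommGroup F]
    [PseudoMetricSpace E] [OpensMeasurableSpace E] (hX : ∀ᶠ i in l, IdentDistrib (X i) X₀ P P)
    {C : F → E} (hC : ∀ᵐ ω ∂P, X₀ ω ∈ closure (Set.range C)) {D Z : ι → Ω → ℝ}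
    (hZ : TendstoInMeasure P Z l (fun _ => 0))
    (hD : ∀ᶠ i in l, ∀ ω u, |D i ω| ≤ dist (X i ω) (C u) + Z i ω * ‖u‖) :
    TendstoInMeasure P D l (fun _ => 0) := by
  rw [tendstoInMeasure_zero_iff] at *
  intro e he
  let G : ℕ → Set E := fun k => Metric.thickening (e / 2) (C '' Metric.ball 0 (k + 1))
  have hGmono : Monotone G := fun i j hij => Metric.thickening_subset_of_subset _
    (Set.image_mono (Metric.ball_subset_ball (by gcongr)))
  have hG : ∀ᵐ ω ∂P, X₀ ω ∈ ⋃ k, G k := by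
    filter_upwards [hC] with ω hω
    obtain ⟨_, ⟨u, rfl⟩, hu⟩ := Metric.mem_closure_iff.1 hω (e / 2) (half_pos he)
    obtain ⟨k, hk⟩ := exists_nat_gt ‖u‖
    have hku : u ∈ Metric.ball 0 ((k : ℝ) + 1) := by rw [mem_ball_zero_iff]; linarith
    exact Set.mem_iUnion.2 ⟨k, Metric.mem_thickening_iff.2 ⟨C u, Set.mem_image_of_mem C hku, hu⟩⟩
  refine tendsto_measure_zero_of_forall_inter_preimage hX
    (fun k => Metric.isOpen_thickening.measurableSet) hGmono hG fun k => ?_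
  refine tendsto_measure_zero_of_subset (hZ (e / 2 / (k + 1)) (by positivity))
    (hD.mono fun i hi => ?_)
  rintro ω ⟨hDω, hXk⟩
  obtain ⟨_, ⟨u, hu, rfl⟩, hXu⟩ := Metric.mem_thickening_iff.1 hXk
  have hDω' : e ≤ |D i ω| := hDω
  change e / 2 / (k + 1) ≤ ‖Z i ω‖
  rw [div_le_iff₀ (by positivity)]
  calc e / 2 ≤ Z i ω * ‖u‖ := by linarith [hi ω u]
    _ ≤ ‖Z i ω‖ * (k + 1) := by
      gcongr
      · exact Real.le_norm_self _
      · exact (mem_ball_zero_iff.1 hu).le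

end IdenticallyDistributed

section HilbertTensor

open scoped TensorProduct

variable {H₁ H₂ : Type*} [NormedAddCommGroup H₁] [InnerProductSpace ℝ H₁]
  [NormedAddCommGroup H₂] [InnerProductSpace ℝ H₂]

lemma tens_apply (x : H₁) (y : H₂) (u : H₁) : tens x y u = ⟪x, u⟫ • y := rfl

lemma norm_tens (x : H₁) (y : H₂) : ‖tens x y‖ = ‖x‖ * ‖y‖ := by
  rw [tens, ContinuousLinearMap.norm_smulRight_apply, innerSL_apply_norm]

lemma continuous_tens : Continuous fun z : H₁ × H₂ => tens z.1 z.2 := by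
  change Continuous fun z : H₁ × H₂ =>
    ContinuousLinearMap.smulRightL ℝ H₁ H₂ (innerSL ℝ z.1) z.2
  fun_prop

/-- The Hilbert space tensor product, a model of the Hilbert-Schmidt operators `H₁ → H₂`. -/
abbrev HilbertTensor (H₁ H₂ : Type*) [NormedAddCommGroup H₁] [InnerProductSpace ℝ H₁]
    [NormedAddCommGroup H₂] [InnerProductSpace ℝ H₂] : Type _ :=
  UniformSpace.Completion (H₁ ⊗[ℝ] H₂)

/-- The elementary tensor `x ⊗ y` as an element of the Hilbert space tensor product, in contrast to
the operator `tens x y`. -/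
def elemTensor (x : H₁) (y : H₂) : HilbertTensor H₁ H₂ := ((x ⊗ₜ[ℝ] y : H₁ ⊗[ℝ] H₂) :)

lemma norm_elemTensor (x : H₁) (y : H₂) : ‖elemTensor x y‖ = ‖x‖ * ‖y‖ := by
  simp [elemTensor]

lemma continuous_elemTensor : Continuous fun z : H₁ × H₂ => elemTensor z.1 z.2 :=
  (UniformSpace.Completion.continuous_coe _).comp TensorProduct.continuous_tmul

lemma elemTensor_sub_elemTensor (x x' : H₁) (y y' : H₂) :
    elemTensor x y - elemTensor x' y' = elemTensor (x - x') y + elemTensor x' (y - y') := by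
  simp only [elemTensor, TensorProduct.sub_tmul, TensorProduct.tmul_sub,
    UniformSpace.Completion.coe_sub]
  abel

/-- The linear extension of `x ⊗ y ↦ tens x y` to the algebraic tensor product. -/
def tensLift : H₁ ⊗[ℝ] H₂ →ₗ[ℝ] H₁ →L[ℝ] H₂ :=
  TensorProduct.lift <| LinearMap.mk₂ ℝ tens
    (fun x x' y => by ext u; simp [tens_apply, inner_add_left, add_smul])
    (fun c x y => by ext u; simp [tens_apply, real_inner_smul_left, mul_smul])
    (fun x y y' => by ext u; simp [tens_apply])
    (fun c x y => by ext u; simp [tens_apply, smul_comm c])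

lemma tensLift_tmul (x : H₁) (y : H₂) : tensLift (x ⊗ₜ y) = tens x y := by
  simp [tensLift]

lemma inner_tensLift_apply (t : H₁ ⊗[ℝ] H₂) (u : H₁) (w : H₂) :
    ⟪tensLift t u, w⟫ = ⟪t, u ⊗ₜ[ℝ] w⟫ := by
  induction t with
  | zero => simp
  | tmul x y => simp [tensLift_tmul, tens_apply, real_inner_smul_left]
  | add s t hs ht => simp [inner_add_left, hs, ht]

lemma norm_tensLift_le (t : H₁ ⊗[ℝ] H₂) : ‖tensLift t‖ ≤ ‖t‖ := by
  refine ContinuousLinearMap.opNorm_le_bound' _ (norm_nonneg t) fun u _ => ?_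
  rcases (norm_nonneg (tensLift t u)).eq_or_lt with h0 | h0
  · rw [← h0]; positivity
  refine le_of_mul_le_mul_right ?_ h0
  calc ‖tensLift t u‖ * ‖tensLift t u‖ = ⟪t, u ⊗ₜ[ℝ] tensLift t u⟫ := by
        rw [← inner_tensLift_apply, real_inner_self_eq_norm_mul_norm]
    _ ≤ ‖t‖ * ‖u ⊗ₜ[ℝ] tensLift t u‖ := real_inner_le_norm (F := H₁ ⊗[ℝ] H₂) t _
    _ = ‖t‖ * ‖u‖ * ‖tensLift t u‖ := by rw [TensorProduct.norm_tmul, mul_assoc]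

/-- The contraction that turns a Hilbert-Schmidt operator, given as an element of the Hilbert space
tensor product, into a bounded operator. -/
def toOp [CompleteSpace H₂] : HilbertTensor H₁ H₂ →L[ℝ] H₁ →L[ℝ] H₂ :=
  tensLift.extendOfNorm
    (UniformSpace.Completion.toComplₗᵢ (𝕜 := ℝ) (E := H₁ ⊗[ℝ] H₂)).toLinearMap

lemma toOp_elemTensor [CompleteSpace H₂] (x : H₁) (y : H₂) :
    toOp (elemTensor x y) = tens x y := by
  rw [← tensLift_tmul]
  exact LinearMap.extendOfNorm_eq UniformSpace.Completion.denseRange_coe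
    ⟨1, fun t => by simpa using norm_tensLift_le t⟩ _

lemma norm_toOp_apply_le [CompleteSpace H₂] (t : HilbertTensor H₁ H₂) : ‖toOp t‖ ≤ ‖t‖ := by
  simpa using! LinearMap.norm_extendOfNorm_apply_le
    (e := (UniformSpace.Completion.toComplₗᵢ (𝕜 := ℝ) (E := H₁ ⊗[ℝ] H₂)).toLinearMap)
    UniformSpace.Completion.denseRange_coe 1
    (fun t : H₁ ⊗[ℝ] H₂ => by simpa using! norm_tensLift_le t) t

variable {α : Type*} [MeasurableSpace α] {μ : Measure α} {X : α → H₁} {W : α → H₂}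

lemma eLpNorm_elemTensor_le {p q r : ℝ≥0∞} [ENNReal.HolderTriple p q r]
    (hX : AEStronglyMeasurable X μ) (hW : AEStronglyMeasurable W μ) :
    eLpNorm (fun x => elemTensor (X x) (W x)) r μ ≤ eLpNorm X p μ * eLpNorm W q μ := by
  simpa using eLpNorm_le_eLpNorm_mul_eLpNorm_of_nnnorm (p := p) (q := q) (r := r) hX hW
    elemTensor 1 (.of_forall fun x => by rw [← NNReal.coe_le_coe]; simp [norm_elemTensor])

lemma memLp_elemTensor {p q r : ℝ≥0∞} [ENNReal.HolderTriple p q r] (hX : MemLp X p μ)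
    (hW : MemLp W q μ) : MemLp (fun x => elemTensor (X x) (W x)) r μ :=
  ⟨continuous_elemTensor.comp_aestronglyMeasurable₂ hX.1 hW.1,
    (eLpNorm_elemTensor_le (p := p) (q := q) hX.1 hW.1).trans_lt (ENNReal.mul_lt_top hX.2 hW.2)⟩

lemma integrable_tens (hX : MemLp X 2 μ) (hW : MemLp W 2 μ) :
    Integrable (fun x => tens (X x) (W x)) μ :=
  memLp_one_iff_integrable.1 <| MemLp.of_bilin (tens : H₁ → H₂ → (H₁ →L[ℝ] H₂)) 1 hX hW
    (continuous_tens.comp_aestronglyMeasurable₂ hX.1 hW.1)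
    (.of_forall fun x => by rw [← NNReal.coe_le_coe]; simp [norm_tens])

lemma inner_integral_tens_apply [CompleteSpace H₂] (hX : MemLp X 2 μ) (hW : MemLp W 2 μ)
    (u : H₁) (w : H₂) :
    ⟪(∫ x, tens (X x) (W x) ∂μ) u, w⟫ = ∫ x, ⟪X x, u⟫ * ⟪W x, w⟫ ∂μ := by
  have hT := integrable_tens hX hW
  rw [ContinuousLinearMap.integral_apply hT, real_inner_comm,
    ← integral_inner (hT.apply_continuousLinearMap u)]
  refine integral_congr_ae (.of_forall fun x => ?_)
  simp only [tens_apply, real_inner_smul_right, real_inner_comm w]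

end HilbertTensor

section ProductMeasure

variable {S : Type*}

/-- The sequence that follows `z.1` at the indices `i < m` and `z.2` from there on. -/
def splice (m : ℕ) (z : (ℕ → S) × (ℕ → S)) : ℕ → S := fun i => if i < m then z.1 i else z.2 i

variable [MeasurableSpace S]

/-- The law of an i.i.d. sequence with marginal `μ`. -/
abbrev iidLaw (μ : Measure S) : Measure (ℕ → S) := Measure.infinitePi fun _ : ℕ => μ

variable (μ : Measure S) [IsProbabilityMeasure μ]

lemma measurePreserving_infinitePi_comp {ι κ : Type*} {σ : κ → ι} (hσ : Function.Injective σ) :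
    MeasurePreserving (fun (p : ι → S) k => p (σ k)) (Measure.infinitePi fun _ : ι => μ)
      (Measure.infinitePi fun _ : κ => μ) :=
  ⟨by fun_prop, Measure.map_infinitePi_infinitePi_of_inj hσ⟩

lemma measurePreserving_sumPiEquivProdPi_symm (ι κ : Type*) :
    MeasurePreserving (MeasurableEquiv.sumPiEquivProdPi fun _ : ι ⊕ κ => S).symm
      ((Measure.infinitePi fun _ : ι => μ).prod (Measure.infinitePi fun _ : κ => μ))
      (Measure.infinitePi fun _ : ι ⊕ κ => μ) := by
  refine ⟨MeasurableEquiv.measurable _, Measure.eq_infinitePi _ fun s t ht => ?_⟩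
  have hpre : (MeasurableEquiv.sumPiEquivProdPi fun _ : ι ⊕ κ => S).symm ⁻¹' Set.pi s t
      = (Set.pi s.toLeft fun i => t (.inl i)) ×ˢ (Set.pi s.toRight fun i => t (.inr i)) := by
    ext z
    simp [Set.mem_pi, Sum.forall, MeasurableEquiv.sumPiEquivProdPi, Equiv.sumPiEquivProdPi]
  rw [MeasurableEquiv.map_apply, hpre, Measure.prod_prod,
    Measure.infinitePi_pi _ (fun i _ => ht _), Measure.infinitePi_pi _ (fun i _ => ht _)]
  conv_rhs => rw [← Finset.toLeft_disjSum_toRight (u := s), Finset.prod_disjSum]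

-- Both sequences read `z`, as a family indexed by `ℕ ⊕ ℕ`, at disjoint sets of indices.
lemma measurePreserving_tail_splice (m : ℕ) :
    MeasurePreserving (fun z : (ℕ → S) × (ℕ → S) => ((fun i => z.1 (i + m)), splice m z))
      ((iidLaw μ).prod (iidLaw μ)) ((iidLaw μ).prod (iidLaw μ)) := by
  let σ : ℕ ⊕ ℕ → ℕ ⊕ ℕ :=
    Sum.elim (fun i => .inl (i + m)) (fun i => if i < m then .inl i else .inr i)
  have hσ : Function.Injective σ := by
    rintro (i | i) (j | j) h <;> simp only [σ, Sum.elim_inl, Sum.elim_inr] at h <;> grind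
  have he := measurePreserving_sumPiEquivProdPi_symm μ ℕ ℕ
  have h := (he.symm _).comp ((measurePreserving_infinitePi_comp μ hσ).comp he)
  convert h using 1
  ext z i
  · rfl
  · by_cases hi : i < m <;>
      simp [splice, hi, σ, MeasurableEquiv.sumPiEquivProdPi, Equiv.sumPiEquivProdPi]

lemma measurePreserving_splice (m : ℕ) :
    MeasurePreserving (splice m) ((iidLaw μ).prod (iidLaw μ)) (iidLaw μ) :=
  measurePreserving_snd.comp (measurePreserving_tail_splice μ m)

lemma measurePreserving_tail (m : ℕ) :
    MeasurePreserving (fun (p : ℕ → S) i => p (i + m)) (iidLaw μ) (iidLaw μ) :=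
  measurePreserving_infinitePi_comp μ (add_left_injective m)

end ProductMeasure

section ApproximableFunctional

variable {S G : Type*} [MeasurableSpace S] [NormedAddCommGroup G] {μ : Measure S} {p : ℝ≥0∞}
  {F : (ℕ → S) → G}

/-- The `L^p` distance of `F (s 0, s 1, …)` and `F (s 0, …, s (m - 1), t m, t (m + 1), …)`
for independent i.i.d. sequences `s` and `t` with marginal `μ`. -/
def couplingDist (μ : Measure S) (p : ℝ≥0∞) (F : (ℕ → S) → G) (m : ℕ) : ℝ≥0∞ :=
  eLpNorm (fun z => F z.1 - F (splice m z)) p ((iidLaw μ).prod (iidLaw μ))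

/-- `F` is an `L^p` functional of an i.i.d. sequence with marginal `μ` that depends so little on
the distant entries of the sequence that its coupling distances are summable. -/
structure IsApproximableFunctional (μ : Measure S) (p : ℝ≥0∞) (F : (ℕ → S) → G) : Prop where
  memLp : MemLp F p (iidLaw μ)
  tsum_couplingDist_lt_top : ∑' m, couplingDist μ p F (m + 1) < ∞

variable [IsProbabilityMeasure μ]

lemma memLp_sub_splice (hF : MemLp F p (iidLaw μ)) (m : ℕ) :
    MemLp (fun z => F z.1 - F (splice m z)) p ((iidLaw μ).prod (iidLaw μ)) :=
  (hF.comp_measurePreserving measurePreserving_fst).sub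
    (hF.comp_measurePreserving (measurePreserving_splice μ m))

lemma IsApproximableFunctional.sub_const (hF : IsApproximableFunctional μ p F) (c : G) :
    IsApproximableFunctional μ p (fun s => F s - c) where
  memLp := hF.memLp.sub (memLp_const c)
  tsum_couplingDist_lt_top := by
    simpa only [couplingDist, sub_sub_sub_cancel_right] using hF.tsum_couplingDist_lt_top

section Tensor

variable {H₁ H₂ : Type*} [NormedAddCommGroup H₁] [InnerProductSpace ℝ H₁]
  [NormedAddCommGroup H₂] [InnerProductSpace ℝ H₂] {q r : ℝ≥0∞} [ENNReal.HolderTriple p q r]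
  {f : (ℕ → S) → H₁} {g : (ℕ → S) → H₂}

lemma couplingDist_elemTensor_le (hr : 1 ≤ r) (hf : MemLp f p (iidLaw μ))
    (hg : MemLp g q (iidLaw μ)) (m : ℕ) :
    couplingDist μ r (fun s => elemTensor (f s) (g s)) m
      ≤ couplingDist μ p f m * eLpNorm g q (iidLaw μ)
        + eLpNorm f p (iidLaw μ) * couplingDist μ q g m := by
  have hspl := measurePreserving_splice μ m
  have hfst := measurePreserving_fst (μ := iidLaw μ) (ν := iidLaw μ)
  have hf' := hf.comp_measurePreserving hspl
  have hg' := hg.comp_measurePreserving hfst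
  have hdf := memLp_sub_splice hf m
  have hdg := memLp_sub_splice hg m
  simp only [couplingDist, elemTensor_sub_elemTensor]
  rw [← eLpNorm_comp_measurePreserving hg.1 hfst, ← eLpNorm_comp_measurePreserving hf.1 hspl]
  exact (eLpNorm_add_le (memLp_elemTensor (p := p) (q := q) (r := r) hdf hg').1
    (memLp_elemTensor (p := p) (q := q) (r := r) hf' hdg).1 hr).trans
      (add_le_add (eLpNorm_elemTensor_le hdf.1 hg'.1) (eLpNorm_elemTensor_le hf'.1 hdg.1))

lemma IsApproximableFunctional.elemTensor (hr : 1 ≤ r) (hf : IsApproximableFunctional μ p f)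
    (hg : IsApproximableFunctional μ q g) :
    IsApproximableFunctional μ r (fun s => elemTensor (f s) (g s)) where
  memLp := memLp_elemTensor (p := p) (q := q) hf.memLp hg.memLp
  tsum_couplingDist_lt_top := by
    refine (ENNReal.tsum_le_tsum fun m =>
      couplingDist_elemTensor_le hr hf.memLp hg.memLp (m + 1)).trans_lt ?_
    rw [ENNReal.tsum_add, ENNReal.tsum_mul_left, ENNReal.tsum_mul_right]
    exact ENNReal.add_lt_top.2 ⟨ENNReal.mul_lt_top hf.tsum_couplingDist_lt_top hg.memLp.2,
      ENNReal.mul_lt_top hf.memLp.2 hg.tsum_couplingDist_lt_top⟩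

end Tensor

section Covariance

variable {α : Type*} [MeasurableSpace α] [InnerProductSpace ℝ G]

lemma integrable_inner {ν : Measure α} {a b : α → G} (ha : MemLp a 2 ν) (hb : MemLp b 2 ν) :
    Integrable (fun x => ⟪a x, b x⟫) ν :=
  memLp_one_iff_integrable.1 <| MemLp.of_bilin (fun x y : G => ⟪x, y⟫) 1 ha hb
    (ha.1.inner hb.1) (.of_forall fun x => by simpa using nnnorm_inner_le_nnnorm (𝕜 := ℝ) _ _)

lemma abs_integral_inner_le {ν : Measure α} {a b : α → G} (ha : MemLp a 2 ν) (hb : MemLp b 2 ν) :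
    |∫ x, ⟪a x, b x⟫ ∂ν| ≤ (eLpNorm a 2 ν).toReal * (eLpNorm b 2 ν).toReal := by
  have h : ⟪ha.toLp a, hb.toLp b⟫ = ∫ x, ⟪a x, b x⟫ ∂ν := by
    rw [L2.inner_def]
    refine integral_congr_ae ?_
    filter_upwards [ha.coeFn_toLp, hb.coeFn_toLp] with x hax hbx
    rw [hax, hbx]
  rw [← h, ← Lp.norm_toLp a ha, ← Lp.norm_toLp b hb]
  exact abs_real_inner_le_norm _ _

variable [CompleteSpace G]

lemma integral_inner_tail_splice_eq_zero (hF : MemLp F 2 (iidLaw μ))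
    (hF0 : ∫ s, F s ∂(iidLaw μ) = 0) (m : ℕ) :
    ∫ z, ⟪F fun i => z.1 (i + m), F (splice m z)⟫ ∂((iidLaw μ).prod (iidLaw μ)) = 0 := by
  have hind : ∫ z, ⟪F z.1, F z.2⟫ ∂((iidLaw μ).prod (iidLaw μ)) = 0 := by
    simpa [hF0] using! integral_prod_bilin (innerSL ℝ) (hF.integrable one_le_two)
      (hF.integrable one_le_two)
  rw [← hind]
  exact (measurePreserving_tail_splice μ m).hasLaw.integral_comp
    (f := fun w : (ℕ → S) × (ℕ → S) => ⟪F w.1, F w.2⟫) (hF.1.comp_fst.inner hF.1.comp_snd)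

lemma abs_integral_inner_tail_le (hF : MemLp F 2 (iidLaw μ)) (hF0 : ∫ s, F s ∂(iidLaw μ) = 0)
    (m : ℕ) :
    |∫ s, ⟪F fun i => s (i + m), F s⟫ ∂(iidLaw μ)|
      ≤ (eLpNorm F 2 (iidLaw μ)).toReal * (couplingDist μ 2 F m).toReal := by
  have hfst := measurePreserving_fst (μ := iidLaw μ) (ν := iidLaw μ)
  have htail := hF.comp_measurePreserving (measurePreserving_tail μ m)
  have htail' : MemLp (fun z : (ℕ → S) × (ℕ → S) => F fun i => z.1 (i + m)) 2
      ((iidLaw μ).prod (iidLaw μ)) :=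
    hF.comp_measurePreserving ((measurePreserving_tail μ m).comp hfst)
  have hself : MemLp (fun z : (ℕ → S) × (ℕ → S) => F z.1) 2 ((iidLaw μ).prod (iidLaw μ)) :=
    hF.comp_measurePreserving hfst
  have hsplice : MemLp (fun z => F (splice m z)) 2 ((iidLaw μ).prod (iidLaw μ)) :=
    hF.comp_measurePreserving (measurePreserving_splice μ m)
  have hdecouple : ∫ s, ⟪F fun i => s (i + m), F s⟫ ∂(iidLaw μ)
      = ∫ z, ⟪F fun i => z.1 (i + m), F z.1 - F (splice m z)⟫ ∂((iidLaw μ).prod (iidLaw μ)) := by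
    simp_rw [inner_sub_right]
    rw [integral_sub (integrable_inner htail' hself) (integrable_inner htail' hsplice),
      integral_inner_tail_splice_eq_zero hF hF0, sub_zero]
    exact (hfst.hasLaw.integral_comp (f := fun s : ℕ → S => ⟪F fun i => s (i + m), F s⟫)
      (htail.1.inner hF.1)).symm
  rw [hdecouple, ← eLpNorm_comp_measurePreserving hF.1 ((measurePreserving_tail μ m).comp hfst)]
  exact abs_integral_inner_le htail' (memLp_sub_splice hF m)

end Covariance

end ApproximableFunctional

section Past

variable {Ω S G : Type*} {δ : ℤ → Ω → S}

lemma coupledPast_eq_splice (n : ℤ) (m : ℕ) (z : Ω × Ω) :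
    coupledPast δ n m z = splice m (past δ n z.1, past δ n z.2) := rfl

lemma past_eq_tail_past (n : ℤ) (m : ℕ) (ω : Ω) :
    past δ n ω = fun i => past δ (n + m) ω (i + m) := by
  ext i
  simp only [past, Nat.cast_add, add_sub_add_right_eq_sub]

variable [MeasurableSpace Ω] [MeasurableSpace S] {P : Measure Ω}

lemma IsIID.measurePreserving_past [IsProbabilityMeasure P] (hδ : IsIID P δ) (n : ℤ) :
    MeasurePreserving (past δ n) P (iidLaw (P.map (δ 0))) := by
  refine ⟨measurable_pi_iff.2 fun i => hδ.measurable _, ?_⟩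
  have hinj : Function.Injective fun i : ℕ => n - (i : ℤ) := fun i j h => by simpa using h
  have hlaw := (hδ.indep.precomp hinj).map_fun_eq_infinitePi_map fun i => hδ.measurable _
  simp_rw [fun i : ℕ => (hδ.ident (n - i)).map_eq] at hlaw
  exact hlaw

variable [IsProbabilityMeasure P]

lemma IsIID.isProbabilityMeasure_map (hδ : IsIID P δ) : IsProbabilityMeasure (P.map (δ 0)) :=
  Measure.isProbabilityMeasure_map (hδ.measurable 0).aemeasurable

lemma IsIID.measurePreserving_past_prod (hδ : IsIID P δ) (n : ℤ) :
    MeasurePreserving (fun z : Ω × Ω => (past δ n z.1, past δ n z.2)) (P.prod P)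
      ((iidLaw (P.map (δ 0))).prod (iidLaw (P.map (δ 0)))) := by
  have := hδ.isProbabilityMeasure_map
  exact (hδ.measurePreserving_past n).prod (hδ.measurePreserving_past n)

variable [NormedAddCommGroup G] [InnerProductSpace ℝ G] [CompleteSpace G] {F : (ℕ → S) → G}

lemma IsIID.abs_integral_inner_past_le (hδ : IsIID P δ)
    (hF : MemLp F 2 (iidLaw (P.map (δ 0)))) (hF0 : ∫ s, F s ∂(iidLaw (P.map (δ 0))) = 0)
    (k l : ℕ) :
    |∫ ω, ⟪F (past δ k ω), F (past δ l ω)⟫ ∂P| ≤ (eLpNorm F 2 (iidLaw (P.map (δ 0)))).toReal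
      * (couplingDist (P.map (δ 0)) 2 F (Nat.dist k l)).toReal := by
  have := hδ.isProbabilityMeasure_map
  wlog hkl : k ≤ l generalizing k l
  · rw [Nat.dist_comm]
    simp_rw [real_inner_comm (F (past δ l _))]
    exact this l k (le_of_not_ge hkl)
  obtain ⟨m, rfl⟩ := Nat.exists_eq_add_of_le hkl
  rw [Nat.dist_eq_sub_of_le hkl, Nat.add_sub_cancel_left]
  refine le_of_eq_of_le ?_ (abs_integral_inner_tail_le hF hF0 m)
  congr 1
  simp_rw [past_eq_tail_past (δ := δ) k m]
  exact (hδ.measurePreserving_past (k + m)).hasLaw.integral_comp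
    (f := fun s : ℕ → S => ⟪F fun i => s (i + m), F s⟫)
    ((hF.comp_measurePreserving (measurePreserving_tail _ m)).1.inner hF.1)

lemma sum_natDist_le {r : ℕ → ℝ} (hr : ∀ m, 0 ≤ r m) (hs : Summable r) (k : ℕ) (s : Finset ℕ) :
    ∑ l ∈ s, r (Nat.dist k l) ≤ 2 * ∑' m, r m := by
  have sum_le_of_injOn : ∀ t : Finset ℕ, Set.InjOn (Nat.dist k) t →
      ∑ l ∈ t, r (Nat.dist k l) ≤ ∑' m, r m := fun t ht => by
    rw [← Finset.sum_image (f := r) ht]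
    exact hs.sum_le_tsum _ fun m _ => hr m
  rw [← Finset.sum_filter_add_sum_filter_not s (k ≤ ·), two_mul]
  refine add_le_add (sum_le_of_injOn _ fun a ha b hb => ?_)
    (sum_le_of_injOn _ fun a ha b hb => ?_) <;>
  · rw [Finset.mem_coe, Finset.mem_filter] at ha hb
    simp only [Nat.dist]
    omega

lemma IsIID.exists_integral_norm_sum_past_sq_le (hδ : IsIID P δ)
    (hF : IsApproximableFunctional (P.map (δ 0)) 2 F)
    (hF0 : ∫ s, F s ∂(iidLaw (P.map (δ 0))) = 0) :
    ∃ c : ℝ, ∀ n : ℕ, ∫ ω, ‖∑ k ∈ Finset.Icc 1 n, F (past δ k ω)‖ ^ 2 ∂P ≤ c * n := by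
  let r : ℕ → ℝ := fun m => (eLpNorm F 2 (iidLaw (P.map (δ 0)))).toReal
    * (couplingDist (P.map (δ 0)) 2 F m).toReal
  have hr : ∀ m, 0 ≤ r m := fun m => by positivity
  have hrs : Summable r := by
    refine Summable.mul_left _ ((summable_nat_add_iff 1).1 ?_)
    exact ENNReal.summable_toReal hF.tsum_couplingDist_lt_top.ne
  have hmem : ∀ k : ℕ, MemLp (fun ω => F (past δ k ω)) 2 P := fun k =>
    hF.memLp.comp_measurePreserving (hδ.measurePreserving_past k)
  refine ⟨2 * ∑' m, r m, fun n => ?_⟩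
  have hexpand : ∫ ω, ‖∑ k ∈ Finset.Icc 1 n, F (past δ k ω)‖ ^ 2 ∂P = ∑ k ∈ Finset.Icc 1 n,
      ∑ l ∈ Finset.Icc 1 n, ∫ ω, ⟪F (past δ k ω), F (past δ l ω)⟫ ∂P := by
    simp_rw [← real_inner_self_eq_norm_sq, sum_inner, inner_sum]
    rw [integral_finsetSum _ fun k _ => integrable_finsetSum _ fun l _ =>
      integrable_inner (hmem k) (hmem l)]
    exact Finset.sum_congr rfl fun k _ =>
      integral_finsetSum _ fun l _ => integrable_inner (hmem k) (hmem l)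
  rw [hexpand]
  calc _ ≤ ∑ k ∈ Finset.Icc 1 n, ∑ l ∈ Finset.Icc 1 n, r (Nat.dist k l) :=
        Finset.sum_le_sum fun k _ => Finset.sum_le_sum fun l _ =>
          (le_abs_self _).trans (hδ.abs_integral_inner_past_le hF.memLp hF0 k l)
    _ ≤ ∑ k ∈ Finset.Icc 1 n, 2 * ∑' m, r m :=
        Finset.sum_le_sum fun k _ => sum_natDist_le hr hrs k _
    _ = (2 * ∑' m, r m) * n := by simp [mul_comm]

end Past

section Approximable

variable {Ω S H : Type*} [MeasurableSpace Ω] [MeasurableSpace S] [NormedAddCommGroup H]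
  [MeasurableSpace H] [BorelSpace H] {P : Measure Ω}

lemma aestronglyMeasurable_of_comp_measurePreserving {T : Ω → S} {μ : Measure S}
    (hT : MeasurePreserving T P μ) {f : S → H} (hf : Measurable f)
    (hfT : AEStronglyMeasurable (f ∘ T) P) : AEStronglyMeasurable f μ := by
  obtain ⟨t, ht, hmem⟩ := hfT.isSeparable_ae_range
  refine aestronglyMeasurable_iff_aemeasurable_separable.2 ⟨hf.aemeasurable, closure t,
    ht.closure, ?_⟩
  rw [← hT.map_eq, ae_map_iff hT.aemeasurable (hf isClosed_closure.measurableSet)]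
  filter_upwards [hmem] with ω hω using subset_closure hω

variable [IsProbabilityMeasure P] {δ : ℤ → Ω → S} {p : ℝ≥0∞} {X : ℕ → Ω → H}

lemma IsLpMApproximable.exists_isApproximableFunctional (hX : IsLpMApproximable p P δ X) :
    ∃ f : (ℕ → S) → H, IsApproximableFunctional (P.map (δ 0)) p f ∧
      ∀ n : ℕ, 1 ≤ n → X n =ᵐ[P] fun ω => f (past δ n ω) := by
  have := hX.iid.isProbabilityMeasure_map
  obtain ⟨f, hf, hXf, hsum⟩ := hX.approx
  have hpast := hX.iid.measurePreserving_past (1 : ℕ)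
  have hf1 : MemLp (fun ω => f (past δ (1 : ℕ) ω)) p P :=
    (memLp_congr_ae (hXf 1 le_rfl)).1 (hX.memLp 1 le_rfl)
  have hfm := aestronglyMeasurable_of_comp_measurePreserving hpast hf hf1.1
  have hfp : MemLp f p (iidLaw (P.map (δ 0))) :=
    ⟨hfm, (eLpNorm_comp_measurePreserving hfm hpast).symm.trans_lt hf1.2⟩
  refine ⟨f, ⟨hfp, lt_of_eq_of_lt (tsum_congr fun m => ?_) hsum⟩, fun n hn => hXf n hn⟩
  rw [couplingDist, ← eLpNorm_comp_measurePreserving (memLp_sub_splice hfp _).1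
    (hX.iid.measurePreserving_past_prod (m + 1 : ℕ))]
  refine eLpNorm_congr_ae ?_
  filter_upwards [Measure.quasiMeasurePreserving_fst.ae_eq_comp (hXf (m + 1) (by lia))] with z hz
  simp only [Function.comp_apply] at hz ⊢
  rw [hz, coupledPast_eq_splice]

lemma IsLpMApproximable.identDistrib (hX : IsLpMApproximable p P δ X) {n : ℕ} (hn : 1 ≤ n) :
    IdentDistrib (X n) (X 1) P P := by
  obtain ⟨f, hf, hXf, -⟩ := hX.approx
  have hpast : IdentDistrib (past δ n) (past δ (1 : ℕ)) P P :=
    ⟨(hX.iid.measurePreserving_past n).aemeasurable, (hX.iid.measurePreserving_past _).aemeasurable,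
      by rw [(hX.iid.measurePreserving_past _).map_eq, (hX.iid.measurePreserving_past _).map_eq]⟩
  exact ((IdentDistrib.of_ae_eq (hX.memLp n hn).1.aemeasurable (hXf n hn)).trans
    (hpast.comp hf)).trans
      (IdentDistrib.of_ae_eq (hX.memLp 1 le_rfl).1.aemeasurable (hXf 1 le_rfl)).symm

end Approximable

section SampleCovariance

variable {Ω S H₁ H₂ : Type*} [MeasurableSpace Ω] [MeasurableSpace S]
  [NormedAddCommGroup H₁] [InnerProductSpace ℝ H₁]
  [NormedAddCommGroup H₂] [InnerProductSpace ℝ H₂]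
  {P : Measure Ω} {δ : ℤ → Ω → S} {X : ℕ → Ω → H₁} {W : ℕ → Ω → H₂}

lemma crossCovHat_sub_integral_tens [CompleteSpace H₂] (hX : MemLp (X 1) 2 P)
    (hW : MemLp (W 1) 2 P) {n : ℕ} (hn : n ≠ 0) (ω : Ω) :
    crossCovHat X W n ω - ∫ ω', tens (X 1 ω') (W 1 ω') ∂P
      = toOp ((n : ℝ)⁻¹ • ∑ k ∈ Finset.Icc 1 n,
          (elemTensor (X k ω) (W k ω) - ∫ ω', elemTensor (X 1 ω') (W 1 ω') ∂P)) := by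
  have hmean : toOp (∫ ω', elemTensor (X 1 ω') (W 1 ω') ∂P)
      = ∫ ω', tens (X 1 ω') (W 1 ω') ∂P := by
    rw [← toOp.integral_comp_comm (memLp_one_iff_integrable.1 (memLp_elemTensor hX hW))]
    simp_rw [toOp_elemTensor]
  simp only [Finset.sum_sub_distrib, Finset.sum_const, Nat.card_Icc, Nat.add_sub_cancel, smul_sub,
    map_sub, map_smul, map_sum, toOp_elemTensor, map_nsmul, hmean, crossCovHat]
  rw [← Nat.cast_smul_eq_nsmul ℝ, inv_smul_smul₀ (Nat.cast_ne_zero.2 hn)]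

instance holderTriple_four_four_two : ENNReal.HolderTriple 4 4 2 where
  inv_add_inv_eq_inv := by
    rw [show (4 : ℝ≥0∞) = 2 * 2 by norm_num, ENNReal.mul_inv (by simp) (by simp), ← mul_add,
      ENNReal.inv_two_add_inv_two, mul_one]

variable [IsProbabilityMeasure P] [MeasurableSpace H₁] [BorelSpace H₁] [MeasurableSpace H₂]
  [BorelSpace H₂]

lemma exists_integral_norm_sum_elemTensor_sub_sq_le (hX : IsLpMApproximable 4 P δ X)
    (hW : IsLpMApproximable 4 P δ W) :
    ∃ c : ℝ, ∀ n : ℕ, ∫ ω, ‖∑ k ∈ Finset.Icc 1 n,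
      (elemTensor (X k ω) (W k ω) - ∫ ω', elemTensor (X 1 ω') (W 1 ω') ∂P)‖ ^ 2 ∂P ≤ c * n := by
  have := hX.iid.isProbabilityMeasure_map
  obtain ⟨f, hf, hXf⟩ := hX.exists_isApproximableFunctional
  obtain ⟨g, hg, hWg⟩ := hW.exists_isApproximableFunctional
  have hF : IsApproximableFunctional (P.map (δ 0)) 2 fun s => elemTensor (f s) (g s) :=
    hf.elemTensor one_le_two hg
  have hmean : ∫ ω, elemTensor (X 1 ω) (W 1 ω) ∂P
      = ∫ s, elemTensor (f s) (g s) ∂(iidLaw (P.map (δ 0))) := by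
    rw [← (hX.iid.measurePreserving_past (1 : ℕ)).hasLaw.integral_comp hF.memLp.1]
    refine integral_congr_ae ?_
    filter_upwards [hXf 1 le_rfl, hWg 1 le_rfl] with ω hXω hWω
    rw [hXω, hWω, Function.comp_apply]
  have hcentred : ∫ s, (elemTensor (f s) (g s) - ∫ ω, elemTensor (X 1 ω) (W 1 ω) ∂P)
      ∂(iidLaw (P.map (δ 0))) = 0 := by
    rw [integral_sub (hF.memLp.integrable one_le_two) (integrable_const _), hmean]
    simp
  obtain ⟨c, hc⟩ := hX.iid.exists_integral_norm_sum_past_sq_le (hF.sub_const _) hcentred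
  refine ⟨c, fun n => le_of_eq_of_le (integral_congr_ae ?_) (hc n)⟩
  have hXW : ∀ᵐ ω ∂P, ∀ k ∈ Finset.Icc 1 n, X k ω = f (past δ k ω) ∧ W k ω = g (past δ k ω) :=
    (Finset.eventually_all _).2 fun k hk =>
      (hXf k (Finset.mem_Icc.1 hk).1).and (hWg k (Finset.mem_Icc.1 hk).1)
  filter_upwards [hXW] with ω hω
  rw [Finset.sum_congr rfl fun k hk => by rw [(hω k hk).1, (hω k hk).2]]

lemma tendstoInMeasure_mul_norm_crossCovHat_sub [CompleteSpace H₂]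
    (hX : IsLpMApproximable 4 P δ X) (hW : IsLpMApproximable 4 P δ W) {a : ℕ → ℝ}
    (ha : a =o[atTop] fun n : ℕ => √n) :
    TendstoInMeasure P
      (fun n ω => a n * ‖crossCovHat X W n ω - ∫ ω', tens (X 1 ω') (W 1 ω') ∂P‖)
      atTop (fun _ => 0) := by
  obtain ⟨c, hc⟩ := exists_integral_norm_sum_elemTensor_sub_sq_le hX hW
  let R : ℕ → Ω → HilbertTensor H₁ H₂ := fun n ω => ∑ k ∈ Finset.Icc 1 n,
    (elemTensor (X k ω) (W k ω) - ∫ ω', elemTensor (X 1 ω') (W 1 ω') ∂P)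
  have hR : ∀ n, MemLp (R n) 2 P := fun n => memLp_finsetSum _ fun k hk =>
    (memLp_elemTensor (p := 4) (q := 4) (hX.memLp k (Finset.mem_Icc.1 hk).1)
      (hW.memLp k (Finset.mem_Icc.1 hk).1)).sub (memLp_const _)
  have hsq : Tendsto (fun n => ∫ ω, ‖(a n / n) • R n ω‖ ^ 2 ∂P) atTop (𝓝 0) := by
    have hlim : Tendsto (fun n : ℕ => c * (a n / √n) ^ 2) atTop (𝓝 0) := by
      simpa using (ha.tendsto_div_nhds_zero.pow 2).const_mul c
    refine squeeze_zero (fun n => by positivity) (fun n => ?_) hlim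
    simp_rw [norm_smul, mul_pow, integral_const_mul, Real.norm_eq_abs, sq_abs]
    rcases n.eq_zero_or_pos with rfl | hn
    · simp
    calc (a n / n) ^ 2 * ∫ ω, ‖R n ω‖ ^ 2 ∂P ≤ (a n / n) ^ 2 * (c * n) := by gcongr; exact hc n
      _ = c * (a n / √n) ^ 2 := by
        rw [div_pow _ (√n), Real.sq_sqrt n.cast_nonneg]; field_simp
  have hT := tendstoInMeasure_zero_of_tendsto_integral_norm_sq
    (fun n => (hR n).const_smul (a n / n)) hsq
  have hX1 : MemLp (X 1) 2 P := (hX.memLp 1 le_rfl).mono_exponent (by norm_num)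
  have hW1 : MemLp (W 1) 2 P := (hW.memLp 1 le_rfl).mono_exponent (by norm_num)
  rw [tendstoInMeasure_zero_iff] at hT ⊢
  intro e he
  refine tendsto_measure_zero_of_subset (hT e he) ?_
  filter_upwards [eventually_ne_atTop 0] with n hn ω hω
  refine (Set.mem_ofPred.1 hω).trans ?_
  rw [norm_mul, norm_norm, crossCovHat_sub_integral_tens hX1 hW1 hn, ← norm_smul, ← map_smul,
    smul_smul, ← div_eq_mul_inv]
  exact norm_toOp_apply_le _

end SampleCovariance

section Support

variable {Ω H : Type*} [MeasurableSpace Ω] {P : Measure Ω}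
  [NormedAddCommGroup H] [InnerProductSpace ℝ H] [CompleteSpace H] {X : Ω → H}

lemma adjoint_integral_tens (hX : MemLp X 2 P) :
    (∫ ω, tens (X ω) (X ω) ∂P).adjoint = ∫ ω, tens (X ω) (X ω) ∂P := by
  refine ((ContinuousLinearMap.eq_adjoint_iff _ _).2 fun x y => ?_).symm
  rw [real_inner_comm _ x, inner_integral_tens_apply hX hX, inner_integral_tens_apply hX hX]
  simp_rw [mul_comm]

lemma ae_inner_eq_zero_of_mem_ker (hX : MemLp X 2 P) {u : H}
    (hu : u ∈ (∫ ω, tens (X ω) (X ω) ∂P).ker) : ∀ᵐ ω ∂P, ⟪X ω, u⟫ = 0 := by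
  have hsq : ∫ ω, ⟪X ω, u⟫ * ⟪X ω, u⟫ ∂P = 0 := by
    rw [← inner_integral_tens_apply hX hX,
      show (∫ ω, tens (X ω) (X ω) ∂P) u = 0 from hu, inner_zero_left]
  have hXu : MemLp (fun ω => ⟪X ω, u⟫) 2 P := hX.inner_const u
  rw [integral_eq_zero_iff_of_nonneg (fun ω => mul_self_nonneg _) (hXu.integrable_mul hXu)] at hsq
  exact hsq.mono fun ω hω => mul_self_eq_zero.1 hω

lemma ae_starProjection_eq_zero_of_forall_ae_inner_eq_zero (hX : AEStronglyMeasurable X P)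
    (U : Submodule ℝ H) [U.HasOrthogonalProjection] (h : ∀ u ∈ U, ∀ᵐ ω ∂P, ⟪X ω, u⟫ = 0) :
    ∀ᵐ ω ∂P, U.starProjection (X ω) = 0 := by
  obtain ⟨t, ht, hmem⟩ :=
    (U.starProjection.continuous.comp_aestronglyMeasurable hX).isSeparable_ae_range
  refine ae_eq_zero_of_forall_dual_of_isSeparable ℝ ht (fun c => ?_) hmem
  obtain ⟨u, rfl⟩ := (InnerProductSpace.toDual ℝ H).surjective c
  filter_upwards [h _ (U.starProjection_apply_mem u)] with ω hω
  rw [InnerProductSpace.toDual_apply_apply, ← Submodule.inner_starProjection_left_eq_right,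
    real_inner_comm]
  exact hω

lemma ae_mem_closure_range_integral_tens (hX : MemLp X 2 P) :
    ∀ᵐ ω ∂P, X ω ∈ closure (Set.range (∫ ω', tens (X ω') (X ω') ∂P : H →L[ℝ] H)) := by
  have hker := (ContinuousLinearMap.isClosed_ker (∫ ω', tens (X ω') (X ω') ∂P)).completeSpace_coe
  filter_upwards [ae_starProjection_eq_zero_of_forall_ae_inner_eq_zero hX.1 _
    fun u hu => ae_inner_eq_zero_of_mem_ker hX hu] with ω hω
  rw [Submodule.starProjection_apply_eq_zero_iff, ContinuousLinearMap.orthogonal_ker,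
    adjoint_integral_tens hX] at hω
  exact hω

variable {S : Type*} [MeasurableSpace S] [MeasurableSpace H] [BorelSpace H]
  [IsProbabilityMeasure P] {δ : ℤ → Ω → S} {p : ℝ≥0∞}

lemma IsLpMApproximable.ae_eq_zero_of_integral_tens_eq_zero {X : ℕ → Ω → H} (hp : 2 ≤ p)
    (hX : IsLpMApproximable p P δ X) (hC : ∫ ω, tens (X 1 ω) (X 1 ω) ∂P = 0) {n : ℕ}
    (hn : 1 ≤ n) : ∀ᵐ ω ∂P, X n ω = 0 := by
  refine (hX.identDistrib hn).symm.ae_mem_snd (measurableSet_singleton 0) ?_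
  filter_upwards [ae_mem_closure_range_integral_tens ((hX.memLp 1 le_rfl).mono_exponent hp)]
    with ω hω
  simpa [hC] using hω

end Support

section DiagonalOperator

variable {ι H : Type*} [NormedAddCommGroup H] [InnerProductSpace ℝ H]
  {s : Finset ι} {a : ι → ℝ} {v : ι → H}

/-- The diagonal operator `∑ j ∈ s, a j • (v j ⊗ v j)`. For an orthonormal family `v` it covers the
spectral decomposition, spectral projections and truncated inverses of a covariance operator. -/
def diagOp (s : Finset ι) (a : ι → ℝ) (v : ι → H) : H →L[ℝ] H := ∑ j ∈ s, a j • tens (v j) (v j)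

lemma diagOp_apply (x : H) : diagOp s a v x = ∑ j ∈ s, (a j * ⟪v j, x⟫) • v j := by
  simp only [diagOp, sum_apply, smul_apply, tens_apply, smul_smul]

lemma norm_diagOp_le (hv : Orthonormal ℝ fun j : s => v j) {b : ℝ} (hb : 0 ≤ b)
    (ha : ∀ j ∈ s, |a j| ≤ b) : ‖diagOp s a v‖ ≤ b := by
  refine (diagOp s a v).opNorm_le_bound hb fun x => ?_
  rw [diagOp_apply, ← Finset.sum_coe_sort s fun j => (a j * ⟪v j, x⟫) • v j]
  refine le_of_sq_le_sq ?_ (by positivity)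
  rw [← real_inner_self_eq_norm_sq, hv.inner_sum, mul_pow]
  calc ∑ j : s, (a j * ⟪v j, x⟫) * (a j * ⟪v j, x⟫)
      ≤ ∑ j : s, b ^ 2 * ‖⟪v j, x⟫‖ ^ 2 := Finset.sum_le_sum fun j _ => by
        rw [← sq, mul_pow, Real.norm_eq_abs, sq_abs]
        exact mul_le_mul_of_nonneg_right (sq_le_sq.2 ((ha j j.2).trans (le_abs_self b)))
          (sq_nonneg _)
    _ ≤ b ^ 2 * ‖x‖ ^ 2 := by
        rw [← Finset.mul_sum]
        exact mul_le_mul_of_nonneg_left (hv.sum_inner_products_le x) (sq_nonneg b)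

lemma norm_sub_diagOp_one_le (hv : Orthonormal ℝ fun j : s => v j) (x : H) :
    ‖x - diagOp s 1 v x‖ ≤ ‖x‖ := by
  have horth : ⟪x - diagOp s 1 v x, diagOp s 1 v x⟫ = 0 := by
    simp only [diagOp_apply, Pi.one_apply, one_mul]
    rw [← Finset.sum_coe_sort s fun j => ⟪v j, x⟫ • v j, inner_sub_left, hv.inner_sum, inner_sum]
    simp [inner_smul_right, real_inner_comm x]
  have hpyth := norm_add_sq_real (x - diagOp s 1 v x) (diagOp s 1 v x)
  rw [horth, sub_add_cancel] at hpyth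
  exact le_of_sq_le_sq (by linarith [sq_nonneg ‖diagOp s 1 v x‖]) (norm_nonneg _)

end DiagonalOperator

section EigenSystem

variable {H : Type*} [NormedAddCommGroup H] [InnerProductSpace ℝ H]
  {T : H →L[ℝ] H} {lam : ℕ → ℝ} {v : ℕ → H}

lemma IsEigenSystem.le_lam_one (h : IsEigenSystem T lam v) {j : ℕ} (hj : 1 ≤ j) : lam j ≤ lam 1 :=
  h.antitone (Set.mem_Ici.2 le_rfl) (Set.mem_Ici.2 hj) hj

lemma IsEigenSystem.orthonormal_of_subset (h : IsEigenSystem T lam v) {s : Finset ℕ}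
    (hs : ∀ j ∈ s, 1 ≤ j ∧ lam j ≠ 0) : Orthonormal ℝ fun j : s => v j :=
  h.orthonormal.comp (fun j : s => ⟨j, hs j j.2⟩) fun _ _ hij =>
    Subtype.ext (congrArg (fun a : {j : ℕ // 1 ≤ j ∧ lam j ≠ 0} => (a : ℕ)) hij)

lemma IsEigenSystem.lam_one_le_norm (h : IsEigenSystem T lam v) : lam 1 ≤ ‖T‖ := by
  by_cases h0 : lam 1 = 0
  · exact h0.trans_le (norm_nonneg T)
  have hv : ‖v 1‖ = 1 := h.orthonormal.1 ⟨1, le_rfl, h0⟩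
  have hTv := T.le_opNorm (v 1)
  rwa [h.eigen 1 le_rfl, norm_smul, hv, mul_one, mul_one, Real.norm_of_nonneg (h.nonneg 1 le_rfl)]
    at hTv

variable [FiniteDimensional ℝ T.range]

lemma IsEigenSystem.finite_support (h : IsEigenSystem T lam v) :
    {j | 1 ≤ j ∧ lam j ≠ 0}.Finite := by
  have hmem : ∀ j : {j : ℕ // 1 ≤ j ∧ lam j ≠ 0}, v j ∈ T.range := fun j => by
    refine ⟨(lam j)⁻¹ • v j, ?_⟩
    simp [h.eigen j j.2.1, smul_smul, j.2.2]
  have hli : LinearIndependent ℝ fun j : {j : ℕ // 1 ≤ j ∧ lam j ≠ 0} =>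
      (⟨v j, hmem j⟩ : T.range) :=
    LinearIndependent.of_comp T.range.subtype h.orthonormal.linearIndependent
  exact Set.finite_coe_iff.1 hli.finite

lemma IsEigenSystem.range_subset_span (h : IsEigenSystem T lam v) :
    Set.range T ⊆ (Submodule.span ℝ (v '' {j | 1 ≤ j ∧ lam j ≠ 0}) : Set H) := by
  have : FiniteDimensional ℝ (Submodule.span ℝ (v '' {j | 1 ≤ j ∧ lam j ≠ 0})) :=
    FiniteDimensional.span_of_finite ℝ (h.finite_support.image v)
  rw [← (Submodule.closed_of_finiteDimensional _).closure_eq, h.complete]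
  exact subset_closure

lemma IsEigenSystem.eq_diagOp (h : IsEigenSystem T lam v) (hT : T.toLinearMap.IsSymmetric) :
    T = diagOp h.finite_support.toFinset lam v := by
  set s := h.finite_support.toFinset with hs
  have hmem : ∀ {j}, j ∈ s → 1 ≤ j ∧ lam j ≠ 0 := fun hj => by simpa [hs] using hj
  have himg : v '' {j | 1 ≤ j ∧ lam j ≠ 0} = Set.range fun j : s => v j := by
    ext y; simp [hs]
  ext x
  have hTx : T x ∈ Submodule.span ℝ (Set.range fun j : s => v j) :=
    himg ▸ h.range_subset_span ⟨x, rfl⟩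
  obtain ⟨c, hc⟩ := (Submodule.mem_span_range_iff_exists_fun ℝ).1 hTx
  have hcoeff : ∀ j : s, c j = lam j * ⟪v j, x⟫ := fun j => by
    rw [← (h.orthonormal_of_subset fun _ => hmem).inner_right_fintype c j, hc,
      ← real_inner_smul_left, ← h.eigen j (hmem j.2).1]
    exact (hT _ _).symm
  simp_rw [diagOp_apply, ← hc, hcoeff]
  exact Finset.sum_coe_sort s fun j => (lam j * ⟪v j, x⟫) • v j

lemma IsEigenSystem.norm_eq_lam_one (h : IsEigenSystem T lam v) (hT : T.toLinearMap.IsSymmetric) :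
    ‖T‖ = lam 1 := by
  refine le_antisymm ?_ h.lam_one_le_norm
  have hs : ∀ j ∈ h.finite_support.toFinset, 1 ≤ j ∧ lam j ≠ 0 := fun j hj => by simpa using hj
  rw [h.eq_diagOp hT]
  refine norm_diagOp_le (h.orthonormal_of_subset hs) (h.nonneg 1 le_rfl) fun j hj => ?_
  rw [abs_of_nonneg (h.nonneg j (hs j hj).1)]
  exact h.le_lam_one (hs j hj).1

lemma IsEigenSystem.le_truncLevel_iff (h : IsEigenSystem T lam v) {m : ℝ} (hm : 0 < m) {j : ℕ}
    (hj : 1 ≤ j) : j ≤ truncLevel lam m ↔ 0 < lam j ∧ lam 1 / m ≤ lam j := by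
  let J : Set ℕ := {j | 1 ≤ j ∧ 0 < lam j ∧ lam 1 / lam j ≤ m}
  have hJ : ∀ {i}, i ∈ J ↔ 1 ≤ i ∧ 0 < lam i ∧ lam 1 / m ≤ lam i := fun {i} =>
    and_congr_right fun _ => and_congr_right fun hi => by rw [div_le_iff₀ hi, div_le_iff₀' hm]
  have hbdd : BddAbove J :=
    (h.finite_support.subset fun _ hi => ⟨hi.1, hi.2.1.ne'⟩).bddAbove
  refine ⟨fun hjK => ?_, fun hjm => le_csSup hbdd (hJ.2 ⟨hj, hjm⟩)⟩
  have hne : J.Nonempty := Set.nonempty_iff_ne_empty.2 fun hempty => by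
    have hK : truncLevel lam m = 0 := by
      change sSup J = 0
      rw [hempty, csSup_empty, bot_eq_zero]
    omega
  obtain ⟨hK, hKpos, hKm⟩ := hJ.1 (Nat.sSup_mem hne hbdd)
  have hle : lam (sSup J) ≤ lam j := h.antitone (Set.mem_Ici.2 hj) (Set.mem_Ici.2 hK) hjK
  exact ⟨hKpos.trans_le hle, hKm.trans hle⟩

lemma IsEigenSystem.orthonormal_Icc_truncLevel (h : IsEigenSystem T lam v) {m : ℝ} (hm : 0 < m) :
    Orthonormal ℝ fun j : Finset.Icc 1 (truncLevel lam m) => v j :=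
  h.orthonormal_of_subset fun _ hj => by
    obtain ⟨hj1, hjK⟩ := Finset.mem_Icc.1 hj
    exact ⟨hj1, ((h.le_truncLevel_iff hm hj1).1 hjK).1.ne'⟩

end EigenSystem

section PrincipalComponents

variable {H H₂ : Type*} [NormedAddCommGroup H] [InnerProductSpace ℝ H]
  [NormedAddCommGroup H₂] [InnerProductSpace ℝ H₂]
  {T : H →L[ℝ] H} {lam : ℕ → ℝ} {v : ℕ → H}

/-- The orthogonal projection onto the first `K` principal components. -/
def pcProj (v : ℕ → H) (K : ℕ) : H →L[ℝ] H := diagOp (Finset.Icc 1 K) 1 v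

/-- The inverse of the covariance operator on the first `K` principal components, extended by zero
to their orthogonal complement. -/
def pcInv (lam : ℕ → ℝ) (v : ℕ → H) (K : ℕ) : H →L[ℝ] H := diagOp (Finset.Icc 1 K) lam⁻¹ v

lemma pcEstimator_eq_pcInv (D : H →L[ℝ] H₂) (K : ℕ) (x : H) :
    pcEstimator D lam v K x = D (pcInv lam v K x) := by
  simp only [pcEstimator, pcInv, diagOp_apply, map_sum, map_smul, Pi.inv_apply, inv_mul_eq_div]

variable [FiniteDimensional ℝ T.range] {m : ℝ}

lemma IsEigenSystem.apply_pcInv_truncLevel (h : IsEigenSystem T lam v) (hm : 0 < m) (x : H) :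
    T (pcInv lam v (truncLevel lam m) x) = pcProj v (truncLevel lam m) x := by
  simp only [pcInv, pcProj, diagOp_apply, map_sum, map_smul]
  refine Finset.sum_congr rfl fun j hj => ?_
  obtain ⟨hj1, hjK⟩ := Finset.mem_Icc.1 hj
  have hpos := ((h.le_truncLevel_iff hm hj1).1 hjK).1
  rw [h.eigen j hj1, smul_smul, Pi.inv_apply, mul_right_comm, inv_mul_cancel₀ hpos.ne',
    Pi.one_apply]

lemma IsEigenSystem.norm_pcInv_truncLevel_le (h : IsEigenSystem T lam v) (hm : 0 < m) :
    ‖pcInv lam v (truncLevel lam m)‖ ≤ m / lam 1 := by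
  have h1 := h.nonneg 1 le_rfl
  refine norm_diagOp_le (h.orthonormal_Icc_truncLevel hm) (by positivity) fun j hj => ?_
  obtain ⟨hj1, hjK⟩ := Finset.mem_Icc.1 hj
  obtain ⟨hpos, hle⟩ := (h.le_truncLevel_iff hm hj1).1 hjK
  have h1pos : 0 < lam 1 := hpos.trans_le (h.le_lam_one hj1)
  rw [Pi.inv_apply, abs_of_pos (inv_pos.2 hpos), ← inv_div]
  exact inv_anti₀ (by positivity) hle

lemma IsEigenSystem.norm_sub_pcProj_comp_le (h : IsEigenSystem T lam v)
    (hT : T.toLinearMap.IsSymmetric) (hm : 0 < m) :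
    ‖T - pcProj v (truncLevel lam m) ∘L T‖ ≤ lam 1 / m := by
  set I := Finset.Icc 1 (truncLevel lam m)
  set s := h.finite_support.toFinset with hs
  have hmem : ∀ {j}, j ∈ s ↔ 1 ≤ j ∧ lam j ≠ 0 := by simp [hs]
  have hIs : I ⊆ s := fun j hj => by
    obtain ⟨hj1, hjK⟩ := Finset.mem_Icc.1 hj
    exact hmem.2 ⟨hj1, ((h.le_truncLevel_iff hm hj1).1 hjK).1.ne'⟩
  have hproj : pcProj v (truncLevel lam m) ∘L T = diagOp I lam v := by
    ext x
    simp only [ContinuousLinearMap.comp_apply, pcProj, diagOp_apply, Pi.one_apply, one_mul]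
    refine Finset.sum_congr rfl fun j hj => ?_
    rw [← real_inner_smul_left, ← h.eigen j (Finset.mem_Icc.1 hj).1]
    exact congrArg (· • v j) (hT _ _).symm
  have htail : T - pcProj v (truncLevel lam m) ∘L T = diagOp (s \ I) lam v := by
    rw [hproj, sub_eq_iff_eq_add]
    exact (h.eq_diagOp hT).trans (Finset.sum_sdiff hIs).symm
  rw [htail]
  refine norm_diagOp_le (h.orthonormal_of_subset fun j hj => hmem.1 (Finset.mem_sdiff.1 hj).1)
    (div_nonneg (h.nonneg 1 le_rfl) hm.le) fun j hj => ?_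
  obtain ⟨hjs, hjI⟩ := Finset.mem_sdiff.1 hj
  obtain ⟨hj1, hj0⟩ := hmem.1 hjs
  have hpos : 0 < lam j := (h.nonneg j hj1).lt_of_ne' hj0
  rw [abs_of_pos hpos]
  by_contra! hlt
  exact hjI (Finset.mem_Icc.2 ⟨hj1, (h.le_truncLevel_iff hm hj1).2 ⟨hpos, hlt.le⟩⟩)

lemma IsEigenSystem.norm_sub_pcProj_le (h : IsEigenSystem T lam v)
    (hT : T.toLinearMap.IsSymmetric) (hm : 0 < m) (C : H →L[ℝ] H) (x u : H) :
    ‖x - pcProj v (truncLevel lam m) x‖ ≤ ‖x - C u‖ + (‖T - C‖ + lam 1 / m) * ‖u‖ := by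
  set Q := pcProj v (truncLevel lam m)
  have hQ : ∀ y, ‖y - Q y‖ ≤ ‖y‖ := norm_sub_diagOp_one_le (h.orthonormal_Icc_truncLevel hm)
  have hdecomp : x - Q x = (x - C u - Q (x - C u)) - ((T - C) u - Q ((T - C) u))
      + (T - Q ∘L T) u := by
    simp only [sub_apply, ContinuousLinearMap.comp_apply, map_sub]
    abel
  calc ‖x - Q x‖ ≤ ‖x - C u‖ + ‖(T - C) u‖ + ‖(T - Q ∘L T) u‖ := by
        rw [hdecomp]
        exact norm_add_le_of_le (norm_sub_le_of_le (hQ _) (hQ _)) le_rfl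
    _ ≤ ‖x - C u‖ + ‖T - C‖ * ‖u‖ + lam 1 / m * ‖u‖ := by
        gcongr
        · exact (T - C).le_opNorm u
        · exact ContinuousLinearMap.le_of_opNorm_le _ (h.norm_sub_pcProj_comp_le hT hm) u
    _ = ‖x - C u‖ + (‖T - C‖ + lam 1 / m) * ‖u‖ := by ring

end PrincipalComponents

section SampleOperators

variable {Ω H H₂ : Type*} [NormedAddCommGroup H] [InnerProductSpace ℝ H]
  [NormedAddCommGroup H₂] [InnerProductSpace ℝ H₂] (X : ℕ → Ω → H) (n : ℕ) (ω : Ω)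

lemma crossCovHat_apply (W : ℕ → Ω → H₂) (x : H) :
    crossCovHat X W n ω x = (n : ℝ)⁻¹ • ∑ k ∈ Finset.Icc 1 n, ⟪X k ω, x⟫ • W k ω := by
  simp only [crossCovHat, smul_apply, sum_apply, tens_apply]

lemma isSymmetric_covHat : (covHat X n ω).toLinearMap.IsSymmetric := fun x y => by
  simp only [covHat, ContinuousLinearMap.coe_coe, crossCovHat_apply, real_inner_smul_left,
    real_inner_smul_right, sum_inner, inner_sum, real_inner_comm x, mul_comm]

instance finiteDimensional_range_covHat : FiniteDimensional ℝ (covHat X n ω).range := by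
  have : FiniteDimensional ℝ (Submodule.span ℝ ((fun k => X k ω) '' Finset.Icc 1 n)) :=
    FiniteDimensional.span_of_finite ℝ ((Finset.finite_toSet _).image _)
  refine Submodule.finiteDimensional_of_le
    (S₂ := Submodule.span ℝ ((fun k => X k ω) '' Finset.Icc 1 n)) ?_
  rintro _ ⟨x, rfl⟩
  rw [ContinuousLinearMap.coe_coe, covHat, crossCovHat_apply]
  exact Submodule.smul_mem _ _ (Submodule.sum_mem _ fun k hk =>
    Submodule.smul_mem _ _ (Submodule.subset_span ⟨k, hk, rfl⟩))

variable {X n ω}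

lemma crossCovHat_eq_of_model {ε Y : ℕ → Ω → H₂} {A : H →L[ℝ] H₂}
    (h : ∀ k, 1 ≤ k → Y k ω = A (X k ω) + ε k ω) :
    crossCovHat X Y n ω = A ∘L covHat X n ω + crossCovHat X ε n ω := by
  ext x
  simp only [covHat, add_apply, ContinuousLinearMap.comp_apply, crossCovHat_apply, map_smul,
    map_sum, ← smul_add, ← Finset.sum_add_distrib]
  congr 1
  exact Finset.sum_congr rfl fun k hk => by rw [h k (Finset.mem_Icc.1 hk).1]

lemma IsEigenSystem.sub_pcEstimator_eq {ε Y : ℕ → Ω → H₂} {A : H →L[ℝ] H₂} {lam : ℕ → ℝ}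
    {v : ℕ → H} (heig : IsEigenSystem (covHat X n ω) lam v)
    (h : ∀ k, 1 ≤ k → Y k ω = A (X k ω) + ε k ω) {m : ℝ} (hm : 0 < m) (x : H) :
    A x - pcEstimator (crossCovHat X Y n ω) lam v (truncLevel lam m) x
      = A (x - pcProj v (truncLevel lam m) x)
        - crossCovHat X ε n ω (pcInv lam v (truncLevel lam m) x) := by
  rw [pcEstimator_eq_pcInv, crossCovHat_eq_of_model h, add_apply, ContinuousLinearMap.comp_apply,
    heig.apply_pcInv_truncLevel hm, map_sub, sub_sub]

end SampleOperators

section Consistency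

variable {Ω S H H₂ : Type*} [MeasurableSpace Ω] [MeasurableSpace S]
  [NormedAddCommGroup H] [InnerProductSpace ℝ H] [CompleteSpace H] [MeasurableSpace H]
  [BorelSpace H] [NormedAddCommGroup H₂] [InnerProductSpace ℝ H₂] [CompleteSpace H₂]
  [MeasurableSpace H₂] [BorelSpace H₂]
  {P : Measure Ω} [IsProbabilityMeasure P] {δ : ℤ → Ω → S} {X : ℕ → Ω → H} {ε : ℕ → Ω → H₂}
  {lam : ℕ → Ω → ℕ → ℝ} {v : ℕ → Ω → ℕ → H} {m : ℕ → ℝ}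

lemma tendstoInMeasure_norm_covHat_sub (hX : IsLpMApproximable 4 P δ X) :
    TendstoInMeasure P (fun n ω => ‖covHat X n ω - ∫ ω', tens (X 1 ω') (X 1 ω') ∂P‖) atTop
      (fun _ => 0) := by
  have hone : (fun _ : ℕ => (1 : ℝ)) =o[atTop] fun n : ℕ => √n := by
    refine (Asymptotics.isLittleO_const_left.2 (Or.inr ?_))
    exact tendsto_norm_atTop_atTop.comp (Real.tendsto_sqrt_atTop.comp tendsto_natCast_atTop_atTop)
  simpa only [one_mul] using! tendstoInMeasure_mul_norm_crossCovHat_sub hX hX hone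

lemma tendstoInMeasure_norm_covHat (hX : IsLpMApproximable 4 P δ X) :
    TendstoInMeasure P (fun n ω => ‖covHat X n ω‖) atTop
      (fun _ => ‖∫ ω', tens (X 1 ω') (X 1 ω') ∂P‖) := by
  have hC := tendstoInMeasure_norm_covHat_sub hX
  rw [tendstoInMeasure_zero_iff] at hC
  rw [tendstoInMeasure_iff_norm]
  refine fun e he => tendsto_measure_zero_of_subset (hC e he) (.of_forall fun n ω hω => ?_)
  rw [Set.mem_ofPred_eq, norm_norm]
  exact le_trans hω (abs_norm_sub_norm_le _ _)

lemma tendstoInMeasure_norm_sub_pcProj (hX : IsLpMApproximable 4 P δ X)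
    (heig : ∀ n, 1 ≤ n → ∀ ω, IsEigenSystem (covHat X n ω) (lam n ω) (v n ω))
    (hm : Tendsto m atTop atTop) :
    TendstoInMeasure P
      (fun n ω => ‖X n ω - pcProj (v n ω) (truncLevel (lam n ω) (m n)) (X n ω)‖) atTop
      (fun _ => 0) := by
  set C := ∫ ω, tens (X 1 ω) (X 1 ω) ∂P
  have hC : TendstoInMeasure P (fun n ω => ‖covHat X n ω - C‖) atTop (fun _ => 0) :=
    tendstoInMeasure_norm_covHat_sub hX
  have hratio : Tendsto (fun n => ‖C‖ / m n) atTop (𝓝 0) := tendsto_const_nhds.div_atTop hm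
  have hZ : TendstoInMeasure P (fun n ω => ‖covHat X n ω - C‖ + lam n ω 1 / m n) atTop
      (fun _ => 0) := by
    refine tendstoInMeasure_zero_of_norm_le_add (tendstoInMeasure_const_mul hC 2)
      (tendstoInMeasure_of_tendsto_const hratio) ?_
    filter_upwards [eventually_ge_atTop 1, hm.eventually_ge_atTop 1] with n hn hmn
    refine .of_forall fun ω => ?_
    have hlam : lam n ω 1 ≤ ‖covHat X n ω - C‖ + ‖C‖ :=
      (heig n hn ω).lam_one_le_norm.trans (norm_le_norm_sub_add _ _)
    have hlam0 := (heig n hn ω).nonneg 1 le_rfl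
    rw [Real.norm_of_nonneg (by positivity)]
    calc ‖covHat X n ω - C‖ + lam n ω 1 / m n
        ≤ ‖covHat X n ω - C‖ + (‖covHat X n ω - C‖ / m n + ‖C‖ / m n) := by
          rw [← add_div]
          gcongr
      _ ≤ 2 * ‖covHat X n ω - C‖ + ‖C‖ / m n := by
          linarith [div_le_self (norm_nonneg (covHat X n ω - C)) hmn]
  refine tendstoInMeasure_zero_of_le_dist_add (X₀ := X 1) (C := C)
    ((eventually_ge_atTop 1).mono fun n hn => hX.identDistrib hn)
    (ae_mem_closure_range_integral_tens ((hX.memLp 1 le_rfl).mono_exponent (by norm_num))) hZ ?_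
  filter_upwards [eventually_ge_atTop 1, hm.eventually_gt_atTop 0] with n hn hmn ω u
  rw [abs_norm, dist_eq_norm]
  exact (heig n hn ω).norm_sub_pcProj_le (isSymmetric_covHat X n ω) hmn C _ u

lemma tendstoInMeasure_norm_crossCovHat_pcInv (hX : IsLpMApproximable 4 P δ X)
    (hε : IsLpMApproximable 4 P δ ε) (hXε : IsOrthogonal P (X 1) (ε 1))
    (heig : ∀ n, 1 ≤ n → ∀ ω, IsEigenSystem (covHat X n ω) (lam n ω) (v n ω))
    (hm : Tendsto m atTop atTop) (hmo : m =o[atTop] fun n : ℕ => √n) :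
    TendstoInMeasure P (fun n ω => ‖crossCovHat X ε n ω
      (pcInv (lam n ω) (v n ω) (truncLevel (lam n ω) (m n)) (X n ω))‖) atTop (fun _ => 0) := by
  by_cases hC : ∫ ω, tens (X 1 ω) (X 1 ω) ∂P = 0
  · refine tendstoInMeasure_zero_of_norm_le
      (tendstoInMeasure_of_tendsto_const tendsto_const_nhds) ?_
    filter_upwards [eventually_ge_atTop 1] with n hn
    filter_upwards [hX.ae_eq_zero_of_integral_tens_eq_zero (by norm_num) hC hn] with ω hω
    simp [hω]
  have hnoise : TendstoInMeasure P (fun n ω => m n * ‖crossCovHat X ε n ω‖) atTop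
      (fun _ => 0) := by
    have h := tendstoInMeasure_mul_norm_crossCovHat_sub hX hε hmo
    rw [hXε] at h
    simpa only [sub_zero] using h
  have hratio := tendstoInMeasure_div hnoise (tendstoInMeasure_norm_covHat hX)
    (norm_ne_zero_iff.2 hC)
  have hident : ∀ᶠ n in atTop, IdentDistrib (X n) (X 1) P P :=
    (eventually_ge_atTop 1).mono fun n hn => hX.identDistrib hn
  refine tendstoInMeasure_zero_of_norm_le (tendstoInMeasure_mul_norm hident hratio) ?_
  filter_upwards [eventually_ge_atTop 1, hm.eventually_gt_atTop 0] with n hn hmn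
  refine .of_forall fun ω => ?_
  have hinv := (heig n hn ω).norm_pcInv_truncLevel_le hmn
  rw [← (heig n hn ω).norm_eq_lam_one (isSymmetric_covHat X n ω)] at hinv
  rw [norm_norm, mul_div_right_comm, mul_comm (m n / _), mul_assoc]
  refine ContinuousLinearMap.le_opNorm_of_le _ ?_
  exact ContinuousLinearMap.le_of_opNorm_le _ hinv _

end Consistency

end FunctionalRegression

end

open FunctionalRegression

theorem theorem2_general
    {Ω S H₁ H₂ : Type*} [MeasurableSpace Ω] [MeasurableSpace S]
    [NormedAddCommGroup H₁] [InnerProductSpace ℝ H₁] [CompleteSpace H₁]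
    [MeasurableSpace H₁] [BorelSpace H₁]
    [NormedAddCommGroup H₂] [InnerProductSpace ℝ H₂] [CompleteSpace H₂]
    [MeasurableSpace H₂] [BorelSpace H₂]
    (P : Measure Ω) [IsProbabilityMeasure P]
    (δ : ℤ → Ω → S) (X : ℕ → Ω → H₁) (ε Y : ℕ → Ω → H₂) (Ψ : H₁ →L[ℝ] H₂)
    (hX : IsLpMApproximable 4 P δ X) (hε : IsLpMApproximable 4 P δ ε)
    (hXε : IsOrthogonal P (X 1) (ε 1))
    (hmodel : ∀ k, 1 ≤ k → ∀ᵐ ω ∂P, Y k ω = Ψ (X k ω) + ε k ω)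
    (lam : ℕ → Ω → ℕ → ℝ) (v : ℕ → Ω → ℕ → H₁)
    (heig : ∀ n, 1 ≤ n → ∀ ω, IsEigenSystem (covHat X n ω) (lam n ω) (v n ω))
    (m : ℕ → ℝ) (hm : Tendsto m atTop atTop) (hmo : m =o[atTop] fun n : ℕ => √n) :
    TendstoInMeasure P
      (fun n ω => ‖Ψ (X n ω) - pcEstimator (crossCovHat X Y n ω) (lam n ω) (v n ω)
        (truncLevel (lam n ω) (m n)) (X n ω)‖)
      atTop (fun _ => 0) := by
  have hproj := tendstoInMeasure_norm_sub_pcProj hX heig hm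
  have hnoise := tendstoInMeasure_norm_crossCovHat_pcInv hX hε hXε heig hm hmo
  refine tendstoInMeasure_zero_of_norm_le_add (tendstoInMeasure_const_mul hproj ‖Ψ‖) hnoise ?_
  have hmodel' : ∀ᵐ ω ∂P, ∀ k, 1 ≤ k → Y k ω = Ψ (X k ω) + ε k ω := by
    simpa only [ae_all_iff] using hmodel
  filter_upwards [eventually_ge_atTop 1, hm.eventually_gt_atTop 0] with n hn hmn
  filter_upwards [hmodel'] with ω hω
  rw [norm_norm, (heig n hn ω).sub_pcEstimator_eq hω hmn]
  exact norm_sub_le_of_le (Ψ.le_opNorm _) le_rfl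

theorem theorem2
    {Ω S H₁ H₂ : Type*} [MeasurableSpace Ω] [MeasurableSpace S]
    [NormedAddCommGroup H₁] [InnerProductSpace ℝ H₁] [CompleteSpace H₁]
    [TopologicalSpace.SeparableSpace H₁] [MeasurableSpace H₁] [BorelSpace H₁]
    [NormedAddCommGroup H₂] [InnerProductSpace ℝ H₂] [CompleteSpace H₂]
    [TopologicalSpace.SeparableSpace H₂] [MeasurableSpace H₂] [BorelSpace H₂]
    (P : Measure Ω) [IsProbabilityMeasure P]
    (δ : ℤ → Ω → S) (X : ℕ → Ω → H₁) (ε Y : ℕ → Ω → H₂) (Ψ : H₁ →L[ℝ] H₂)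
    (hA : FunctionalRegression.AssumptionA P δ X ε)
    (hmodel : ∀ k, 1 ≤ k → ∀ᵐ ω ∂P, Y k ω = Ψ (X k ω) + ε k ω)
    (lam : ℕ → Ω → ℕ → ℝ) (v : ℕ → Ω → ℕ → H₁)
    (heig : ∀ n, 1 ≤ n → ∀ ω,
      FunctionalRegression.IsEigenSystem (FunctionalRegression.covHat X n ω) (lam n ω) (v n ω))
    (m : ℕ → ℝ) (hm : Tendsto m atTop atTop)
    (hmo : m =o[atTop] fun n : ℕ => Real.sqrt n) :
    TendstoInMeasure P
      (fun n ω => ‖Ψ (X n ω) - FunctionalRegression.pcEstimator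
        (FunctionalRegression.crossCovHat X Y n ω) (lam n ω) (v n ω)
        (FunctionalRegression.truncLevel (lam n ω) (m n)) (X n ω)‖)
      atTop (fun _ => 0) :=
  theorem2_general P δ X ε Y Ψ hA.approx_X hA.approx_ε (hA.orthogonal 1 le_rfl) hmodel lam v heig
    m hm hmo
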